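/- Let $n\ge 1$, $0<\alpha<n$, and let $b:\mathbb{R}^n\to\mathbb{R}$ be locally integrable. All cubes have sides parallel to the coordinate axes and positive side length. For a measurable function $f$ on $\mathbb{R}^n$ put $$M_\alpha f(x)=\sup_{Q\ni x}\frac{1}{|Q|^{1-\alpha/n}}\int_Q|f(y)|\,dy,\qquad [b,M_\alpha](f)(x)=b(x)M_\alpha(f)(x)-M_\alpha(bf)(x),$$ where the supremum is over all cubes $Q$ containing $x$, and for a cube $Q_0$ and $x\in Q_0$ let $$M_{\alpha,Q_0}f(x)=\sup_{x\in Q\subseteq Q_0}\frac{1}{|Q|^{1-\alpha/n}}\int_Q|f(y)|\,dy,$$ where the supremum is over all cubes $Q$ with $x\in Q\subseteq Q_0$. Write $b_Q=\frac1{|Q|}\int_Q b$ and $b^-=\max(-b,0)$; $b\in BMO(\mathbb{R}^n)$ means that $\sup_Q\frac1{|Q|}\int_Q|b-b_Q|\,dx<\infty$. We say that $[b,M_\alpha]$ is bounded from $L^p(\mathbb{R}^n)$ to $L^q(\mathbb{R}^n)$ if there is a constant $C$ such that for every $f\in L^p(\mathbb{R}^n)$ the functions $M_\alpha(f)$ and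 $M_\alpha(bf)$ are finite almost everywhere, $[b,M_\alpha](f)\in L^q(\mathbb{R}^n)$ and $\|[b,M_\alpha](f)\|_{L^q}\le C\|f\|_{L^p}$. Then the following statements are equivalent: (1) $b\in BMO(\mathbb{R}^n)$ and $b^-\in L^\infty(\mathbb{R}^n)$. (2) $[b,M_\alpha]$ is bounded from $L^p(\mathbb{R}^n)$ to $L^q(\mathbb{R}^n)$ for some $p$ and $q$ such that $1<p<n/\alpha$ and $1/q=1/p-\alpha/n$. (3) $[b,M_\alpha]$ is bounded from $L^p(\mathbb{R}^n)$ to $L^q(\mathbb{R}^n)$ for all $p$ and $q$ such that $1<p<n/\alpha$ and $1/q=1/p-\alpha/n$. (4) There exists $s\in[1,\infty)$ such that $$\sup_Q\left(\frac1{|Q|}\int_Q\left|b(x)-|Q|^{-\alpha/n}M_{\alpha,Q}(b)(x)\right|^s dx\right)^{1/s}<\infty,$$ where the supremum is over all cubes $Q\subset\mathbb{R}^n$. (5) For all $s\in[1,\infty)$ the supremum in (4) is finite. -/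

import Mathlib

open MeasureTheory
open scoped ENNReal NNReal

noncomputable section

/-! Throughout, `Fin n → ℝ` is used as `ℝⁿ` with Lebesgue measure `volume` and its usual topology;
no norm on `ℝⁿ` enters the definitions below. -/

/-- A cube in `ℝⁿ`: a product of `n` closed intervals of the same length `l > 0`. -/
def IsCube {n : ℕ} (Q : Set (Fin n → ℝ)) : Prop :=
  ∃ (a : Fin n → ℝ) (l : ℝ), 0 < l ∧ Q = {y | ∀ i, a i ≤ y i ∧ y i ≤ a i + l}

/-- The fractional maximal function `M_α f (x)`, with values in `[0, ∞]`: the supremum of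
`|Q|^{-(1 - α/n)} ∫_Q |f|` over all cubes `Q` containing `x`. -/
def fracMax {n : ℕ} (α : ℝ) (f : (Fin n → ℝ) → ℝ) (x : Fin n → ℝ) : ℝ≥0∞ :=
  ⨆ (Q : Set (Fin n → ℝ)) (_ : IsCube Q) (_ : x ∈ Q),
    (∫⁻ y in Q, ‖f y‖ₑ) / volume Q ^ (1 - α / n)

/-- The fractional maximal function `M_{α,Q₀} f (x)` relative to `Q₀`, with values in `[0, ∞]`:
the supremum runs over the cubes `Q` with `x ∈ Q ⊆ Q₀`. -/
def fracMaxOn {n : ℕ} (α : ℝ) (Q₀ : Set (Fin n → ℝ)) (f : (Fin n → ℝ) → ℝ)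
    (x : Fin n → ℝ) : ℝ≥0∞ :=
  ⨆ (Q : Set (Fin n → ℝ)) (_ : IsCube Q) (_ : x ∈ Q) (_ : Q ⊆ Q₀),
    (∫⁻ y in Q, ‖f y‖ₑ) / volume Q ^ (1 - α / n)

/-- The nonlinear commutator `[b, M_α] f (x) = b(x) M_α f (x) - M_α (b f) (x)`. The value is
meaningful at the points where both maximal functions are finite. -/
def fracCommutator {n : ℕ} (α : ℝ) (b f : (Fin n → ℝ) → ℝ) (x : Fin n → ℝ) : ℝ :=
  b x * (fracMax α f x).toReal - (fracMax α (fun y => b y * f y) x).toReal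

/-- `[b, M_α]` is bounded from `L^p(ℝⁿ)` to `L^q(ℝⁿ)`: for every `f ∈ L^p` the function
`[b, M_α] f` is well defined almost everywhere (both maximal functions in it are finite a.e.),
belongs to `L^q`, and has `L^q`-norm at most `C ‖f‖_p` with `C` independent of `f`. -/
def FracCommutatorBounded {n : ℕ} (α : ℝ) (b : (Fin n → ℝ) → ℝ) (p q : ℝ) : Prop :=
  ∃ C : ℝ≥0, ∀ f : (Fin n → ℝ) → ℝ, MemLp f (ENNReal.ofReal p) volume →
    (∀ᵐ x, fracMax α f x < ∞ ∧ fracMax α (fun y => b y * f y) x < ∞) ∧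
    MemLp (fracCommutator α b f) (ENNReal.ofReal q) volume ∧
    eLpNorm (fracCommutator α b f) (ENNReal.ofReal q) volume
      ≤ C * eLpNorm f (ENNReal.ofReal p) volume

/-- `f ∈ BMO(ℝⁿ)`: `f` is locally integrable and `sup_Q ⨍_Q |f - f_Q| < ∞` over all cubes `Q`,
where `f_Q` is the average of `f` over `Q`. -/
def IsBMO {n : ℕ} (f : (Fin n → ℝ) → ℝ) : Prop :=
  LocallyIntegrable f volume ∧
    (⨆ (Q : Set (Fin n → ℝ)) (_ : IsCube Q), (∫⁻ x in Q, ‖f x - ⨍ y in Q, f y‖ₑ) / volume Q) < ∞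

/-- `sup_Q (⨍_Q |b(x) - |Q|^{-α/n} M_{α,Q}(b)(x)|^s dx)^{1/s}` over all cubes `Q`, in `[0, ∞]`.
For locally integrable `b` and `0 < α < n` the function `M_{α,Q}(b)` is finite a.e. on `Q`. -/
def fracOscillation {n : ℕ} (α : ℝ) (b : (Fin n → ℝ) → ℝ) (s : ℝ) : ℝ≥0∞ :=
  ⨆ (Q : Set (Fin n → ℝ)) (_ : IsCube Q),
    ((∫⁻ x in Q, ‖b x - (volume Q ^ (-α / n) * fracMaxOn α Q b x).toReal‖ₑ ^ s) / volume Q) ^ (1 / s)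

end

/-! ### Cubes as closed balls of the sup norm, and Vitali's covering lemma. -/

section Cubes

open Metric Filter Topology

variable {n : ℕ}

/-! Write m for the mean b_Q and |b|_Q for the mean of |b| over Q. Everything passes through a
one-sided condition, `HasUpperDeviationBound`: the averages over Q of ((|b|_Q - b)⁺)^s are bounded
uniformly in Q. It forces (1) because b - m has mean zero on Q, m ≤ |b|_Q, and b⁻ ≤ |b| - b
(`HasUpperDeviationBound.isBMO`). It follows from (2) by testing the commutator on indicators of
cubes, for M_α(1_Q) = |Q|^{α/n} and M_α(b 1_Q) ≥ |Q|^{α/n} |b|_Q on Q. It follows from (4) because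
|Q|^{-α/n} M_{α,Q}(b) ≥ |b|_Q on Q.

For (1) ⇒ (3), |b(x)| M_α f(x) and M_α(bf)(x) differ by at most the maximal commutator, the supremum
over Q ∋ x of |Q|^{α/n-1} ∫_Q |b(x) - b(y)| |f(y)| dy, while replacing |b| by b costs 2 ‖b⁻‖_∞ M_α
f. The maximal commutator is bounded in `HasOscillationBound.exists_majorant` by inserting m. The
term with |b(y) - m| yields to Hölder and the John-Nirenberg inequality. For the term with |b(x) -
m|, cubes are sorted by the dyadic size of their fractional average of |f|; at each level a Vitali
selection leaves disjoint cubes, and the deviations of all cubes inside a fivefold enlargement are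
controlled by one function, `maxDeviation`, with bounded L^q means there.

For (1) ⇒ (5), |Q|^{-α/n} M_{α,Q}(b) lies between |m| and |m| plus the Hardy-Littlewood maximal
function of |b - m| 1_Q, and |m| - m is bounded because b⁻ is.

The analytic tools are the weak and strong type bounds for maximal functions, Hedberg's inequality,
and John-Nirenberg, all obtained from Vitali coverings. -/

theorem isCube_iff {Q : Set (Fin n → ℝ)} :
    IsCube Q ↔ ∃ (c : Fin n → ℝ) (r : ℝ), 0 < r ∧ Q = closedBall c r := by
  have key : ∀ (c : Fin n → ℝ) (r : ℝ), 0 < r →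
      closedBall c r = {y | ∀ i, c i - r ≤ y i ∧ y i ≤ c i - r + 2 * r} := by
    intro c r hr
    ext y
    simp only [mem_closedBall, dist_pi_le_iff hr.le, Real.dist_eq, abs_le, Set.mem_ofPred_eq]
    refine forall_congr' fun i => ?_
    constructor <;> rintro ⟨h1, h2⟩ <;> constructor <;> linarith
  constructor
  · rintro ⟨a, l, hl, rfl⟩
    refine ⟨fun i => a i + l / 2, l / 2, by positivity, ?_⟩
    rw [key _ _ (by positivity)]
    ext y
    refine forall_congr' fun i => ?_
    constructor <;> rintro ⟨h1, h2⟩ <;> constructor <;> linarith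
  · rintro ⟨c, r, hr, rfl⟩
    exact ⟨fun i => c i - r, 2 * r, by positivity, key c r hr⟩

theorem isCube_closedBall (c : Fin n → ℝ) {r : ℝ} (hr : 0 < r) : IsCube (closedBall c r) :=
  isCube_iff.2 ⟨c, r, hr, rfl⟩

theorem volume_cube (c : Fin n → ℝ) {r : ℝ} (hr : 0 < r) :
    volume (closedBall c r) = ENNReal.ofReal ((2 * r) ^ n) := by
  rw [Real.volume_pi_closedBall c hr.le, Fintype.card_fin]

theorem volume_cube_ne_zero (c : Fin n → ℝ) {r : ℝ} (hr : 0 < r) :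
    volume (closedBall c r) ≠ 0 := (measure_closedBall_pos volume c hr).ne'

theorem volume_cube_ne_top (c : Fin n → ℝ) (r : ℝ) : volume (closedBall c r) ≠ ∞ :=
  measure_closedBall_lt_top.ne

theorem volume_cube_mul (c c' : Fin n → ℝ) {k r : ℝ} (hk : 0 < k) (hr : 0 < r) :
    volume (closedBall c (k * r)) = ENNReal.ofReal k ^ n * volume (closedBall c' r) := by
  rw [volume_cube c (mul_pos hk hr), volume_cube c' hr, ← ENNReal.ofReal_pow hk.le,
    ← ENNReal.ofReal_mul (by positivity)]
  congr 1
  ring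

theorem IsCube.measurableSet {Q : Set (Fin n → ℝ)} (hQ : IsCube Q) : MeasurableSet Q := by
  obtain ⟨c, r, -, rfl⟩ := isCube_iff.1 hQ
  exact measurableSet_closedBall

theorem IsCube.volume_ne_zero {Q : Set (Fin n → ℝ)} (hQ : IsCube Q) : volume Q ≠ 0 := by
  obtain ⟨c, r, hr, rfl⟩ := isCube_iff.1 hQ
  exact volume_cube_ne_zero c hr

theorem IsCube.volume_ne_top {Q : Set (Fin n → ℝ)} (hQ : IsCube Q) : volume Q ≠ ∞ := by
  obtain ⟨c, r, -, rfl⟩ := isCube_iff.1 hQ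
  exact volume_cube_ne_top c r

theorem IsCube.isCompact {Q : Set (Fin n → ℝ)} (hQ : IsCube Q) : IsCompact Q := by
  obtain ⟨c, r, -, rfl⟩ := isCube_iff.1 hQ
  exact isCompact_closedBall c r

/-- Radii of cubes of bounded measure are bounded. -/
theorem exists_radius_bound (hn : n ≠ 0) {V : ℝ≥0∞} (hV : V ≠ ∞) :
    ∃ R : ℝ, ∀ (c : Fin n → ℝ) (r : ℝ), 0 < r → volume (closedBall c r) ≤ V → r ≤ R := by
  -- For r > 1 the volume (2r)^n is at least 2r, so it exceeds V as soon as r does.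
  refine ⟨max 1 V.toReal, fun c r hr h => ?_⟩
  by_contra! hlt
  have h1 : 1 < r := lt_of_le_of_lt (le_max_left _ _) hlt
  have h2 : V.toReal < r := lt_of_le_of_lt (le_max_right _ _) hlt
  rw [volume_cube c hr, ENNReal.ofReal_le_iff_le_toReal hV] at h
  have h3 : 2 * r ≤ (2 * r) ^ n := le_self_pow₀ (by linarith) hn
  linarith

/-- Vitali's covering lemma for a family of cubes of bounded size, given by centre and radius. -/
theorem exists_disjoint_cubes (t : Set ((Fin n → ℝ) × ℝ)) (R : ℝ)
    (hpos : ∀ a ∈ t, 0 < a.2) (hR : ∀ a ∈ t, a.2 ≤ R) :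
    ∃ u ⊆ t, u.Countable ∧ u.PairwiseDisjoint (fun a => closedBall a.1 a.2) ∧
      ∀ a ∈ t, ∃ b ∈ u, closedBall a.1 a.2 ⊆ closedBall b.1 (5 * b.2) := by
  obtain ⟨u, hut, hdisj, hcov⟩ := Vitali.exists_disjoint_subfamily_covering_enlargement_closedBall
    t (fun a => a.1) (fun a => a.2) R hR 5 (by norm_num)
  refine ⟨u, hut, hdisj.countable_of_nonempty_interior fun a ha => ?_, hdisj, hcov⟩
  exact (nonempty_ball.2 (hpos a (hut ha))).mono ball_subset_interior_closedBall

theorem tsum_volume_le {u : Set ((Fin n → ℝ) × ℝ)} (hu : u.Countable)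
    (hd : u.PairwiseDisjoint (fun a => closedBall a.1 a.2)) (S : Set (Fin n → ℝ))
    (hS : ∀ a ∈ u, closedBall a.1 a.2 ⊆ S) :
    ∑' a : u, volume (closedBall a.1.1 a.1.2) ≤ volume S := by
  rw [← measure_biUnion hu hd fun _ _ => measurableSet_closedBall]
  exact measure_mono (Set.iUnion₂_subset hS)

theorem tsum_lintegral_le {u : Set ((Fin n → ℝ) × ℝ)} (hu : u.Countable)
    (hd : u.PairwiseDisjoint (fun a => closedBall a.1 a.2)) (S : Set (Fin n → ℝ))
    (hS : ∀ a ∈ u, closedBall a.1 a.2 ⊆ S) (g : (Fin n → ℝ) → ℝ≥0∞) :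
    ∑' a : u, ∫⁻ y in closedBall a.1.1 a.1.2, g y ≤ ∫⁻ y in S, g y := by
  rw [← lintegral_biUnion hu (fun _ _ => measurableSet_closedBall) hd]
  exact lintegral_mono_set (Set.iUnion₂_subset hS)

end Cubes

/-! ### Maximal functions: measurability and weak type (1, 1). -/

section MaximalFunction

open Metric Filter Topology

variable {n : ℕ}

/-- The fractional maximal function of a function with values in `[0, ∞]`; for `α = 0` it is the
Hardy-Littlewood maximal function. -/
noncomputable def eFracMax (α : ℝ) (g : (Fin n → ℝ) → ℝ≥0∞) (x : Fin n → ℝ) : ℝ≥0∞ :=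
  ⨆ (Q : Set (Fin n → ℝ)) (_ : IsCube Q) (_ : x ∈ Q), (∫⁻ y in Q, g y) / volume Q ^ (1 - α / n)

theorem fracMax_eq (α : ℝ) (f : (Fin n → ℝ) → ℝ) : fracMax α f = eFracMax α fun y => ‖f y‖ₑ := rfl

theorem le_eFracMax {α : ℝ} {g : (Fin n → ℝ) → ℝ≥0∞} {x : Fin n → ℝ} {Q : Set (Fin n → ℝ)}
    (hQ : IsCube Q) (hx : x ∈ Q) :
    (∫⁻ y in Q, g y) / volume Q ^ (1 - α / n) ≤ eFracMax α g x :=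
  le_iSup_of_le Q (le_iSup_of_le hQ (le_iSup_of_le hx le_rfl))

theorem average_le_eFracMax {g : (Fin n → ℝ) → ℝ≥0∞} {x : Fin n → ℝ} {Q : Set (Fin n → ℝ)}
    (hQ : IsCube Q) (hx : x ∈ Q) : (∫⁻ y in Q, g y) / volume Q ≤ eFracMax 0 g x := by
  simpa using le_eFracMax (α := 0) (g := g) hQ hx

theorem lt_eFracMax_iff {α : ℝ} {g : (Fin n → ℝ) → ℝ≥0∞} {x : Fin n → ℝ} {t : ℝ≥0∞} :
    t < eFracMax α g x ↔ ∃ Q : Set (Fin n → ℝ), IsCube Q ∧ x ∈ Q ∧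
      t < (∫⁻ y in Q, g y) / volume Q ^ (1 - α / n) := by
  simp only [eFracMax, lt_iSup_iff, exists_prop]

theorem eFracMax_le_iff {α : ℝ} {g : (Fin n → ℝ) → ℝ≥0∞} {x : Fin n → ℝ} {t : ℝ≥0∞} :
    eFracMax α g x ≤ t ↔ ∀ Q : Set (Fin n → ℝ), IsCube Q → x ∈ Q →
      (∫⁻ y in Q, g y) / volume Q ^ (1 - α / n) ≤ t := by
  simp only [eFracMax, iSup_le_iff]

theorem eFracMax_congr {α : ℝ} {g h : (Fin n → ℝ) → ℝ≥0∞} (hgh : g =ᵐ[volume] h) :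
    eFracMax α g = eFracMax α h := by
  funext x
  simp only [eFracMax]
  refine iSup_congr fun Q => iSup_congr fun _ => iSup_congr fun _ => ?_
  rw [lintegral_congr_ae (ae_restrict_of_ae hgh)]

/-- The volume depends continuously on the radius, so a cube whose quotient exceeds t can be
enlarged slightly and still beat t; the enlarged cube has x in its interior and serves all nearby
points. This gives measurability without any assumption on g. -/
theorem lowerSemicontinuous_eFracMax (α : ℝ) (g : (Fin n → ℝ) → ℝ≥0∞) :
    LowerSemicontinuous (eFracMax α g) := by
  intro x t ht
  obtain ⟨Q, hQ, hx, hlt⟩ := lt_eFracMax_iff.1 ht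
  obtain ⟨c, r, hr, rfl⟩ := isCube_iff.1 hQ
  have hpow : ∀ s : ℝ, 0 < s → volume (closedBall c s) ^ (1 - α / n) ≠ 0 ∧
      volume (closedBall c s) ^ (1 - α / n) ≠ ∞ := fun s hs =>
    ⟨by simp [ENNReal.rpow_eq_zero_iff, volume_cube_ne_zero c hs, volume_cube_ne_top],
      by simp [ENNReal.rpow_eq_top_iff, volume_cube_ne_zero c hs, volume_cube_ne_top]⟩
  have htop : t ≠ ∞ := ht.ne_top
  rw [ENNReal.lt_div_iff_mul_lt (Or.inl (hpow r hr).1) (Or.inl (hpow r hr).2)] at hlt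
  have hcont : Tendsto (fun s : ℝ => t * ENNReal.ofReal ((2 * s) ^ n) ^ (1 - α / n)) (𝓝[>] r)
      (𝓝 (t * ENNReal.ofReal ((2 * r) ^ n) ^ (1 - α / n))) := by
    refine ENNReal.Tendsto.const_mul ?_ (Or.inr htop)
    refine ((ENNReal.continuous_rpow_const.tendsto _).comp ?_)
    refine Tendsto.mono_left ?_ nhdsWithin_le_nhds
    exact (ENNReal.continuous_ofReal.comp (by fun_prop : Continuous fun s : ℝ => (2 * s) ^ n)).tendsto r
  rw [volume_cube c hr] at hlt
  obtain ⟨s, hs, hrs⟩ := ((hcont.eventually_lt_const hlt).and self_mem_nhdsWithin).exists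
  have hs0 : 0 < s := hr.trans hrs
  have hxs : x ∈ ball c s := mem_ball.2 (lt_of_le_of_lt (mem_closedBall.1 hx) hrs)
  filter_upwards [isOpen_ball.mem_nhds hxs] with z hz
  refine lt_of_lt_of_le ?_ (le_eFracMax (isCube_closedBall c hs0) (ball_subset_closedBall hz))
  rw [ENNReal.lt_div_iff_mul_lt (Or.inl (hpow s hs0).1) (Or.inl (hpow s hs0).2), volume_cube c hs0]
  exact hs.trans_le (lintegral_mono_set (closedBall_subset_closedBall (le_of_lt hrs)))

theorem measurable_eFracMax (α : ℝ) (g : (Fin n → ℝ) → ℝ≥0∞) : Measurable (eFracMax α g) :=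
  (lowerSemicontinuous_eFracMax α g).measurable

/-- The weak type `(1, 1)` estimate for the Hardy-Littlewood maximal function. -/
theorem weak_type_eFracMax (hn : n ≠ 0) (g : (Fin n → ℝ) → ℝ≥0∞) {t : ℝ≥0∞} (ht : t ≠ 0) :
    volume {x | t < eFracMax 0 g x} ≤ 5 ^ n * (∫⁻ y, g y) / t := by
  rcases eq_or_ne t ∞ with rfl | htt
  · simp
  -- A finite integral is what bounds the radii of the competing cubes, as the covering lemma
  -- requires.
  rcases eq_or_ne (∫⁻ y, g y) ∞ with hg | hg
  · rw [hg, ENNReal.mul_top (by positivity), ENNReal.top_div_of_ne_top htt]; exact le_top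
  set F : Set ((Fin n → ℝ) × ℝ) :=
    {a | 0 < a.2 ∧ t * volume (closedBall a.1 a.2) ≤ ∫⁻ y in closedBall a.1 a.2, g y} with hF
  obtain ⟨R, hR⟩ := exists_radius_bound hn (V := (∫⁻ y, g y) / t)
    (ENNReal.div_ne_top hg ht)
  obtain ⟨u, huF, hu, hd, hcov⟩ := exists_disjoint_cubes F R (fun a ha => ha.1) (fun a ha => by
    refine hR a.1 a.2 ha.1 ?_
    rw [ENNReal.le_div_iff_mul_le (Or.inl ht) (Or.inl htt), mul_comm]
    exact ha.2.trans (setLIntegral_le_lintegral _ _))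
  have hsub : {x | t < eFracMax 0 g x} ⊆ ⋃ a ∈ u, closedBall a.1 (5 * a.2) := by
    intro x hx
    obtain ⟨Q, hQ, hxQ, hlt⟩ := lt_eFracMax_iff.1 hx
    obtain ⟨c, r, hr, rfl⟩ := isCube_iff.1 hQ
    rw [zero_div, sub_zero, ENNReal.rpow_one, ENNReal.lt_div_iff_mul_lt
      (Or.inl (volume_cube_ne_zero c hr)) (Or.inl (volume_cube_ne_top c r))] at hlt
    obtain ⟨a, ha, hsub⟩ := hcov (c, r) ⟨hr, hlt.le⟩
    exact Set.mem_biUnion ha (hsub hxQ)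
  have hvol : ∀ a : u, volume (closedBall a.1.1 (5 * a.1.2))
      ≤ 5 ^ n / t * ∫⁻ y in closedBall a.1.1 a.1.2, g y := fun a => by
    have h := huF a.2
    rw [volume_cube_mul _ a.1.1 (by norm_num) h.1, ENNReal.ofReal_ofNat, div_eq_mul_inv, mul_assoc]
    gcongr
    rw [mul_comm, ← div_eq_mul_inv, ENNReal.le_div_iff_mul_le (Or.inl ht) (Or.inl htt), mul_comm]
    exact h.2
  calc volume {x | t < eFracMax 0 g x} ≤ volume (⋃ a ∈ u, closedBall a.1 (5 * a.2)) :=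
        measure_mono hsub
    _ ≤ ∑' a : u, volume (closedBall a.1.1 (5 * a.1.2)) := measure_biUnion_le volume hu _
    _ ≤ ∑' a : u, 5 ^ n / t * ∫⁻ y in closedBall a.1.1 a.1.2, g y := ENNReal.tsum_le_tsum hvol
    _ = 5 ^ n / t * ∑' a : u, ∫⁻ y in closedBall a.1.1 a.1.2, g y := ENNReal.tsum_mul_left
    _ ≤ 5 ^ n / t * ∫⁻ y in Set.univ, g y := by
        gcongr
        exact tsum_lintegral_le hu hd _ (fun _ _ => Set.subset_univ _) g
    _ = 5 ^ n * (∫⁻ y, g y) / t := by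
        rw [Measure.restrict_univ, div_eq_mul_inv, div_eq_mul_inv, mul_right_comm]

/-- The level in the weak type estimate tends to infinity. -/
theorem eFracMax_zero_lt_top_ae (hn : n ≠ 0) {g : (Fin n → ℝ) → ℝ≥0∞} (hg : ∫⁻ y, g y ≠ ∞) :
    ∀ᵐ x, eFracMax 0 g x < ∞ := by
  have h0 : ∀ k : ℕ, volume {x | eFracMax 0 g x = ∞} ≤ 5 ^ n * (∫⁻ y, g y) / ((k + 1 : ℕ) : ℝ≥0∞) :=
    fun k => (measure_mono fun x (hx : _ = _) => by
      simp [hx, ENNReal.natCast_lt_top]).trans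
        (weak_type_eFracMax hn g (t := ((k + 1 : ℕ) : ℝ≥0∞)) (by simp))
  have hlim : Tendsto (fun k : ℕ => 5 ^ n * (∫⁻ y, g y) / ((k + 1 : ℕ) : ℝ≥0∞)) atTop (𝓝 0) := by
    have h := (ENNReal.Tendsto.const_mul (a := 5 ^ n * (∫⁻ y, g y))
      ENNReal.tendsto_inv_nat_nhds_zero (Or.inr (ENNReal.mul_ne_top (by simp) hg)))
    rw [mul_zero] at h
    exact h.comp (tendsto_add_atTop_nat 1)
  have hz : volume {x | eFracMax 0 g x = ∞} = 0 := le_antisymm (ge_of_tendsto' hlim h0) zero_le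
  rw [ae_iff]
  simpa using hz

/-- The weak type estimate after removal of the part of `g` below `t`. -/
theorem weak_type_eFracMax_truncated (hn : n ≠ 0) {g : (Fin n → ℝ) → ℝ≥0∞} (hg : Measurable g)
    {t : ℝ≥0∞} (ht : t ≠ 0) :
    volume {x | 2 * t < eFracMax 0 g x} ≤ 5 ^ n * (∫⁻ y in {y | t < g y}, g y) / t := by
  have hS : MeasurableSet {y | t < g y} := measurableSet_lt measurable_const hg
  rw [← lintegral_indicator hS]
  refine (measure_mono fun x hx => ?_).trans (weak_type_eFracMax hn _ ht)
  obtain ⟨Q, hQ, hxQ, hlt⟩ := lt_eFracMax_iff.1 hx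
  refine lt_of_lt_of_le ?_ (le_eFracMax hQ hxQ)
  rw [zero_div, sub_zero, ENNReal.rpow_one] at hlt ⊢
  rw [ENNReal.lt_div_iff_mul_lt (Or.inl hQ.volume_ne_zero) (Or.inl hQ.volume_ne_top)] at hlt ⊢
  -- The part of g below t contributes at most t to an average, so an average above 2t leaves more
  -- than t for the truncated function.
  have hle : ∫⁻ y in Q, g y ≤ (∫⁻ y in Q, {y | t < g y}.indicator g y) + t * volume Q := by
    rw [← setLIntegral_const, ← lintegral_add_right _ measurable_const]
    refine lintegral_mono fun y => ?_
    by_cases hy : t < g y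
    · simp [Set.indicator, hy]
    · simp [Set.indicator, hy, not_lt.1 hy]
  rcases eq_or_ne t ∞ with rfl | htt
  · simp at hx
  rw [mul_assoc, two_mul] at hlt
  exact lt_of_add_lt_add_right (hlt.trans_le hle)

end MaximalFunction

/-! ### A discrete layer-cake formula over powers of 2. -/

section DyadicSums

theorem two_zpow_rpow (k : ℤ) (q : ℝ) : ((2 : ℝ≥0∞) ^ k) ^ q = (2 : ℝ≥0∞) ^ (k * q) := by
  rw [← ENNReal.rpow_intCast, ← ENNReal.rpow_mul]

/-- For finite nonzero F a single term suffices: the k with 2^k < F ≤ 2^(k+1). For F = ∞ the terms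
with k ≥ 0 already diverge. -/
theorem rpow_le_dyadic_sum {q : ℝ} (hq : 0 < q) (F : ℝ≥0∞) :
    F ^ q ≤ 2 ^ q * ∑' k : ℤ, if (2 : ℝ≥0∞) ^ k < F then ((2 : ℝ≥0∞) ^ k) ^ q else 0 := by
  rcases eq_or_ne F 0 with rfl | h0
  · simp [hq]
  rcases eq_or_ne F ∞ with rfl | htop
  · have hsum : ∑' k : ℤ, (if (2 : ℝ≥0∞) ^ k < ∞ then ((2 : ℝ≥0∞) ^ k) ^ q else 0) = ∞ := by
      refine top_unique ?_
      calc (∞ : ℝ≥0∞) = ∑' _ : ℕ, (1 : ℝ≥0∞) :=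
            (ENNReal.tsum_const_eq_top_of_ne_zero one_ne_zero).symm
        _ ≤ ∑' k : ℕ, (if (2 : ℝ≥0∞) ^ (k : ℤ) < ∞ then ((2 : ℝ≥0∞) ^ (k : ℤ)) ^ q else 0) := by
            refine ENNReal.tsum_le_tsum fun k => ?_
            rw [if_pos (by rw [zpow_natCast]; exact ENNReal.pow_lt_top (by simp)), zpow_natCast]
            exact ENNReal.one_le_rpow (one_le_pow₀ (by norm_num)) hq
        _ ≤ _ := ENNReal.tsum_comp_le_tsum_of_injective
            (f := fun k : ℕ => (k : ℤ)) Nat.cast_injective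
            (fun k : ℤ => if (2 : ℝ≥0∞) ^ k < ∞ then ((2 : ℝ≥0∞) ^ k) ^ q else 0)
    rw [hsum, ENNReal.mul_top (by simp [ENNReal.rpow_eq_zero_iff])]
    exact le_top
  obtain ⟨k, hk1, hk2⟩ := ENNReal.exists_mem_Ioc_zpow h0 htop (y := 2) (by norm_num) (by simp)
  calc F ^ q ≤ ((2 : ℝ≥0∞) ^ (k + 1)) ^ q := ENNReal.rpow_le_rpow hk2 hq.le
    _ = 2 ^ q * ((2 : ℝ≥0∞) ^ k) ^ q := by
        rw [two_zpow_rpow, two_zpow_rpow, ← ENNReal.rpow_add _ _ (by simp) (by simp)]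
        congr 1
        push_cast
        ring
    _ ≤ _ := by
        gcongr
        refine le_trans ?_ (ENNReal.le_tsum k)
        rw [if_pos hk1]

/-- Below the top level the terms form a geometric series of ratio 2^(-q), so the sum is comparable
to its largest term. -/
theorem exists_dyadic_sum_le {q : ℝ} (hq : 0 < q) :
    ∃ C : ℝ≥0∞, C ≠ ∞ ∧ ∀ F : ℝ≥0∞,
      (∑' k : ℤ, if (2 : ℝ≥0∞) ^ k < F then ((2 : ℝ≥0∞) ^ k) ^ q else 0) ≤ C * F ^ q := by
  have hr : (2 : ℝ≥0∞) ^ (-q) < 1 := ENNReal.rpow_lt_one_of_one_lt_of_neg (by norm_num) (by linarith)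
  refine ⟨(1 - 2 ^ (-q))⁻¹, ENNReal.inv_ne_top.2 (tsub_pos_of_lt hr).ne', fun F => ?_⟩
  rcases eq_or_ne F 0 with rfl | h0
  · simp
  rcases eq_or_ne F ∞ with rfl | htop
  · rw [ENNReal.top_rpow_of_pos hq, ENNReal.mul_top]
    · exact le_top
    · exact ENNReal.inv_ne_zero.2 (ENNReal.sub_ne_top (by simp))
  obtain ⟨K, hK1, hK2⟩ := ENNReal.exists_mem_Ioc_zpow h0 htop (y := 2) (by norm_num) (by simp)
  have hinj : Function.Injective fun j : ℕ => K - (j : ℤ) := fun i j h => by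
    simpa using h
  calc (∑' k : ℤ, if (2 : ℝ≥0∞) ^ k < F then ((2 : ℝ≥0∞) ^ k) ^ q else 0)
      ≤ ∑' k : ℤ, if k ≤ K then ((2 : ℝ≥0∞) ^ k) ^ q else 0 := by
        refine ENNReal.tsum_le_tsum fun k => ?_
        split_ifs with h1 h2
        · exact le_rfl
        · exfalso
          have h3 : (2 : ℝ≥0∞) ^ (K + 1) ≤ 2 ^ k :=
            ENNReal.zpow_le_of_le (by norm_num) (by omega)
          exact absurd (h1.trans_le hK2) (not_lt.2 h3)
        · exact zero_le
        · exact le_rfl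
    _ = ∑' j : ℕ, ((2 : ℝ≥0∞) ^ K) ^ q * ((2 : ℝ≥0∞) ^ (-q)) ^ j := by
        rw [← hinj.tsum_eq]
        · refine tsum_congr fun j => ?_
          rw [if_pos (by omega), two_zpow_rpow, two_zpow_rpow, ← ENNReal.rpow_natCast,
            ← ENNReal.rpow_mul, ← ENNReal.rpow_add _ _ (by simp) (by simp)]
          congr 1
          push_cast
          ring
        · intro k hk
          have : k ≤ K := by
            by_contra h
            simp [h] at hk
          exact ⟨(K - k).toNat, by simp only; omega⟩
    _ = (1 - 2 ^ (-q))⁻¹ * ((2 : ℝ≥0∞) ^ K) ^ q := by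
        rw [ENNReal.tsum_mul_left, ENNReal.tsum_geometric, mul_comm]
    _ ≤ _ := by gcongr

/-- With the reverse estimate below, this converts between integrals of powers and the measures of
superlevel sets, with constants depending only on q. -/
theorem lintegral_rpow_le_dyadic_sum {β : Type*} [MeasurableSpace β] {μ : Measure β} {q : ℝ}
    (hq : 0 < q) {F : β → ℝ≥0∞} (hF : Measurable F) :
    ∫⁻ x, F x ^ q ∂μ ≤ 2 ^ q * ∑' k : ℤ, ((2 : ℝ≥0∞) ^ k) ^ q * μ {x | (2 : ℝ≥0∞) ^ k < F x} := by
  have hS : ∀ k : ℤ, MeasurableSet {x | (2 : ℝ≥0∞) ^ k < F x} := fun k =>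
    measurableSet_lt measurable_const hF
  calc ∫⁻ x, F x ^ q ∂μ ≤ ∫⁻ x, 2 ^ q * ∑' k : ℤ,
        {x | (2 : ℝ≥0∞) ^ k < F x}.indicator (fun _ => ((2 : ℝ≥0∞) ^ k) ^ q) x ∂μ := by
        refine lintegral_mono fun x => (rpow_le_dyadic_sum hq (F x)).trans_eq ?_
        simp [Set.indicator]
    _ = _ := by
        rw [lintegral_const_mul _ (Measurable.tsum fun k => measurable_const.indicator (hS k)),
          lintegral_tsum fun k => (measurable_const.indicator (hS k)).aemeasurable]
        simp_rw [lintegral_indicator_const (hS _)]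

theorem exists_dyadic_sum_le_lintegral {q : ℝ} (hq : 0 < q) :
    ∃ C : ℝ≥0∞, C ≠ ∞ ∧ ∀ {β : Type} [MeasurableSpace β] (μ : Measure β) (F : β → ℝ≥0∞),
      Measurable F →
      ∑' k : ℤ, ((2 : ℝ≥0∞) ^ k) ^ q * μ {x | (2 : ℝ≥0∞) ^ k < F x} ≤ C * ∫⁻ x, F x ^ q ∂μ := by
  obtain ⟨C, hC, h⟩ := exists_dyadic_sum_le hq
  refine ⟨C, hC, fun {β} _ μ F hF => ?_⟩
  have hS : ∀ k : ℤ, MeasurableSet {x | (2 : ℝ≥0∞) ^ k < F x} := fun k =>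
    measurableSet_lt measurable_const hF
  rw [← lintegral_const_mul _ (hF.pow_const q)]
  simp_rw [← lintegral_indicator_const (hS _)]
  rw [← lintegral_tsum fun k => (measurable_const.indicator (hS k)).aemeasurable]
  refine lintegral_mono fun x => le_trans (le_of_eq ?_) (h (F x))
  simp [Set.indicator]

end DyadicSums

/-! ### Strong type bounds for the Hardy-Littlewood and fractional maximal functions. -/

section StrongType

variable {n : ℕ}

/-- Marcinkiewicz interpolation between weak (1, 1) and L^∞, done by hand: the truncated weak type
bound is applied at each level 2^k, and after interchanging sum and integral the sum of 2^(k(p-1))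
over 2^k < g is at most a multiple of g^(p-1). This is where p > 1 enters. -/
theorem exists_strong_type_eFracMax_zero (hn : n ≠ 0) {p : ℝ} (hp : 1 < p) :
    ∃ C : ℝ≥0∞, C ≠ ∞ ∧ ∀ g : (Fin n → ℝ) → ℝ≥0∞, AEMeasurable g →
      ∫⁻ x, eFracMax 0 g x ^ p ≤ C * ∫⁻ x, g x ^ p := by
  obtain ⟨C, hC, h⟩ := exists_dyadic_sum_le (q := p - 1) (by linarith)
  have hp0 : 0 < p := by linarith
  refine ⟨2 ^ p * (2 ^ p * (5 ^ n * C)), ?_, fun g hg => ?_⟩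
  · have h2 : (2 : ℝ≥0∞) ^ p ≠ ∞ := ENNReal.rpow_ne_top_of_nonneg hp0.le (by simp)
    exact ENNReal.mul_ne_top h2 (ENNReal.mul_ne_top h2 (ENNReal.mul_ne_top (by simp) hC))
  wlog hgm : Measurable g generalizing g
  · rw [eFracMax_congr hg.ae_eq_mk, show ∫⁻ x, g x ^ p = ∫⁻ x, hg.mk g x ^ p from
      lintegral_congr_ae (hg.ae_eq_mk.fun_comp fun y => y ^ p)]
    exact this _ hg.measurable_mk.aemeasurable hg.measurable_mk
  -- Halving absorbs the factor 2 in the level of the truncated weak type estimate.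
  set G : (Fin n → ℝ) → ℝ≥0∞ := fun x => eFracMax 0 g x / 2 with hG
  have hGm : Measurable G := (measurable_eFracMax 0 g).div_const 2
  have hS : ∀ k : ℤ, MeasurableSet {x | (2 : ℝ≥0∞) ^ k < g x} := fun k =>
    measurableSet_lt measurable_const hgm
  have hterm : ∀ k : ℤ, ((2 : ℝ≥0∞) ^ k) ^ p * volume {x | (2 : ℝ≥0∞) ^ k < G x}
      ≤ 5 ^ n * ∫⁻ x, {x | (2 : ℝ≥0∞) ^ k < g x}.indicator
        (fun x => ((2 : ℝ≥0∞) ^ k) ^ (p - 1) * g x) x := fun k => by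
    have h0 : (2 : ℝ≥0∞) ^ k ≠ 0 := (ENNReal.zpow_pos (by simp) (by simp) k).ne'
    have ht : (2 : ℝ≥0∞) ^ k ≠ ∞ := (ENNReal.zpow_lt_top (by simp) (by simp) k).ne
    have hset : {x | (2 : ℝ≥0∞) ^ k < G x} = {x | 2 * (2 : ℝ≥0∞) ^ k < eFracMax 0 g x} := by
      ext x
      simp only [hG, Set.mem_ofPred_eq]
      rw [ENNReal.lt_div_iff_mul_lt (by simp) (by simp), mul_comm]
    rw [hset, lintegral_indicator (hS k), lintegral_const_mul _ hgm]
    calc ((2 : ℝ≥0∞) ^ k) ^ p * volume {x | 2 * (2 : ℝ≥0∞) ^ k < eFracMax 0 g x}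
        ≤ ((2 : ℝ≥0∞) ^ k) ^ p * (5 ^ n * (∫⁻ y in {y | (2 : ℝ≥0∞) ^ k < g y}, g y) / 2 ^ k) := by
          gcongr
          exact weak_type_eFracMax_truncated hn hgm h0
      _ = 5 ^ n * (((2 : ℝ≥0∞) ^ k) ^ p / 2 ^ k * ∫⁻ y in {y | (2 : ℝ≥0∞) ^ k < g y}, g y) := by
          simp only [div_eq_mul_inv]
          ring
      _ = _ := by
          rw [ENNReal.rpow_sub _ _ h0 ht, ENNReal.rpow_one]
  calc ∫⁻ x, eFracMax 0 g x ^ p = 2 ^ p * ∫⁻ x, G x ^ p := by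
        rw [← lintegral_const_mul _ (hGm.pow_const p)]
        refine lintegral_congr fun x => ?_
        rw [← ENNReal.mul_rpow_of_nonneg _ _ hp0.le, hG]
        simp only
        rw [ENNReal.mul_div_cancel (by simp) (by simp)]
    _ ≤ 2 ^ p * (2 ^ p * ∑' k : ℤ, ((2 : ℝ≥0∞) ^ k) ^ p * volume {x | (2 : ℝ≥0∞) ^ k < G x}) := by
        gcongr
        exact lintegral_rpow_le_dyadic_sum hp0 hGm
    _ ≤ 2 ^ p * (2 ^ p * ∑' k : ℤ, 5 ^ n * ∫⁻ x, {x | (2 : ℝ≥0∞) ^ k < g x}.indicator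
        (fun x => ((2 : ℝ≥0∞) ^ k) ^ (p - 1) * g x) x) := by
        refine mul_le_mul_right (mul_le_mul_right (ENNReal.tsum_le_tsum hterm) _) _
    _ = 2 ^ p * (2 ^ p * (5 ^ n * ∫⁻ x, ∑' k : ℤ, {x | (2 : ℝ≥0∞) ^ k < g x}.indicator
        (fun x => ((2 : ℝ≥0∞) ^ k) ^ (p - 1) * g x) x)) := by
        rw [ENNReal.tsum_mul_left, lintegral_tsum fun k => ?_]
        exact ((hgm.const_mul _).indicator (hS k)).aemeasurable
    _ ≤ 2 ^ p * (2 ^ p * (5 ^ n * ∫⁻ x, C * g x ^ p)) := by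
        gcongr with x
        calc (∑' k : ℤ, {x | (2 : ℝ≥0∞) ^ k < g x}.indicator
              (fun x => ((2 : ℝ≥0∞) ^ k) ^ (p - 1) * g x) x)
            = (∑' k : ℤ, if (2 : ℝ≥0∞) ^ k < g x then ((2 : ℝ≥0∞) ^ k) ^ (p - 1) else 0) * g x := by
              rw [← ENNReal.tsum_mul_right]
              refine tsum_congr fun k => ?_
              simp [Set.indicator, ite_mul]
          _ ≤ C * g x ^ (p - 1) * g x := by gcongr; exact h _
          _ = C * g x ^ p := by
              rw [mul_assoc]
              congr 1
              nth_rewrite 2 [← ENNReal.rpow_one (g x)]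
              rw [← ENNReal.rpow_add_of_nonneg _ _ (by linarith) zero_le_one, sub_add_cancel]
    _ = 2 ^ p * (2 ^ p * (5 ^ n * C)) * ∫⁻ x, g x ^ p := by
        rw [lintegral_const_mul _ (hgm.pow_const p)]
        ring

theorem lintegral_le_rpow_mul_measure_univ {β : Type*} [MeasurableSpace β] {μ : Measure β} {p : ℝ}
    (hp : 1 ≤ p) {g : β → ℝ≥0∞} (hg : AEMeasurable g μ) :
    ∫⁻ x, g x ∂μ ≤ (∫⁻ x, g x ^ p ∂μ) ^ (1 / p) * μ Set.univ ^ (1 - 1 / p) := by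
  rcases hp.eq_or_lt with rfl | hp1
  · simp
  have h := ENNReal.lintegral_mul_le_Lp_mul_Lq μ (Real.HolderConjugate.conjExponent hp1) hg
    (aemeasurable_const (b := (1 : ℝ≥0∞)))
  simp only [Pi.mul_apply, mul_one, ENNReal.one_rpow, lintegral_const, one_mul] at h
  convert h using 3
  have := (Real.HolderConjugate.conjExponent hp1).inv_add_inv_eq_one
  rw [one_div, one_div]
  linarith

theorem lintegral_add_rpow_le {β : Type*} [MeasurableSpace β] {μ : Measure β} {q : ℝ} (hq : 1 ≤ q)
    (F : β → ℝ≥0∞) {G : β → ℝ≥0∞} (hG : AEMeasurable G μ) :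
    ∫⁻ x, (F x + G x) ^ q ∂μ ≤ 2 ^ (q - 1) * ((∫⁻ x, F x ^ q ∂μ) + ∫⁻ x, G x ^ q ∂μ) := by
  have h2 : (2 : ℝ≥0∞) ^ (q - 1) ≠ ∞ := ENNReal.rpow_ne_top_of_nonneg (by linarith) (by simp)
  rw [← lintegral_add_right' _ (hG.pow_const q), ← lintegral_const_mul' _ _ h2]
  exact lintegral_mono fun x => ENNReal.rpow_add_le_mul_rpow_add_rpow _ _ hq

/-- Hedberg's inequality. -/
theorem eFracMax_le_hedberg {α p q : ℝ} (hp : 1 ≤ p) (hpq : p ≤ q) (hα : 1 / q = 1 / p - α / n)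
    {g : (Fin n → ℝ) → ℝ≥0∞} (hg : AEMeasurable g) (x : Fin n → ℝ) :
    eFracMax α g x ≤ ((∫⁻ y, g y ^ p) ^ (1 / p)) ^ (1 - p / q) * eFracMax 0 g x ^ (p / q) := by
  have hp0 : 0 < p := by linarith
  have hq0 : 0 < q := by linarith
  have hθ : 0 ≤ 1 - p / q := by rw [sub_nonneg, div_le_one hq0]; exact hpq
  refine eFracMax_le_iff.2 fun Q hQ hx => ?_
  set V := volume Q with hV
  have hV0 : V ≠ 0 := hQ.volume_ne_zero
  have hVt : V ≠ ∞ := hQ.volume_ne_top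
  set I := ∫⁻ y in Q, g y with hI
  set N := (∫⁻ y, g y ^ p) ^ (1 / p) with hN
  have hI1 : I ≤ N * V ^ (1 - 1 / p) := by
    refine (lintegral_le_rpow_mul_measure_univ hp hg.restrict).trans ?_
    rw [Measure.restrict_apply_univ]
    exact mul_le_mul_left (ENNReal.rpow_le_rpow (setLIntegral_le_lintegral _ _) (by positivity)) _
  -- The first factor is bounded by Hölder through the global norm, the second by the maximal
  -- function; the relation between p, q and α makes the powers of the volume match.
  have hI2 : I = I ^ (1 - p / q) * I ^ (p / q) := by
    rw [← ENNReal.rpow_add_of_nonneg _ _ hθ (by positivity), sub_add_cancel, ENNReal.rpow_one]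
  have hexp : V ^ ((1 - 1 / p) * (1 - p / q)) = V ^ (1 - α / n) * (V ^ (p / q))⁻¹ := by
    rw [← ENNReal.rpow_neg, ← ENNReal.rpow_add _ _ hV0 hVt]
    congr 1
    have : α / n = 1 / p - 1 / q := by linarith
    rw [this]
    field_simp
    ring
  rw [ENNReal.div_le_iff (by simp [ENNReal.rpow_eq_zero_iff, hV0, hVt])
    (by simp [ENNReal.rpow_eq_top_iff, hV0, hVt])]
  calc I = I ^ (1 - p / q) * I ^ (p / q) := hI2
    _ ≤ (N * V ^ (1 - 1 / p)) ^ (1 - p / q) * I ^ (p / q) := by gcongr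
    _ = N ^ (1 - p / q) * (I / V) ^ (p / q) * V ^ (1 - α / n) := by
        rw [ENNReal.mul_rpow_of_nonneg _ _ hθ, ← ENNReal.rpow_mul V, hexp,
          ENNReal.div_rpow_of_nonneg _ _ (by positivity), div_eq_mul_inv (I ^ _)]
        ring
    _ ≤ _ := by
        gcongr
        exact average_le_eFracMax hQ hx

/-- The q-th power of Hedberg's bound contains the Hardy-Littlewood function exactly to the power p,
so its L^p bound suffices. -/
theorem exists_strong_type_eFracMax (hn : n ≠ 0) {α p q : ℝ} (hp : 1 < p) (hpq : p ≤ q)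
    (hα : 1 / q = 1 / p - α / n) :
    ∃ C : ℝ≥0∞, C ≠ ∞ ∧ ∀ g : (Fin n → ℝ) → ℝ≥0∞, AEMeasurable g →
      ∫⁻ x, eFracMax α g x ^ q ≤ C * (∫⁻ x, g x ^ p) ^ (q / p) := by
  have hp0 : 0 < p := by linarith
  have hq0 : 0 < q := by linarith
  obtain ⟨C, hC, h⟩ := exists_strong_type_eFracMax_zero hn hp
  refine ⟨C, hC, fun g hg => ?_⟩
  set A := ∫⁻ x, g x ^ p with hA
  calc ∫⁻ x, eFracMax α g x ^ q
      ≤ ∫⁻ x, A ^ (q / p - 1) * eFracMax 0 g x ^ p := by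
        refine lintegral_mono fun x => ?_
        refine (ENNReal.rpow_le_rpow (eFracMax_le_hedberg hp.le hpq hα hg x) hq0.le).trans_eq ?_
        rw [ENNReal.mul_rpow_of_nonneg _ _ hq0.le, ← ENNReal.rpow_mul, ← ENNReal.rpow_mul,
          ← ENNReal.rpow_mul]
        congr 2 <;> field_simp
    _ = A ^ (q / p - 1) * ∫⁻ x, eFracMax 0 g x ^ p :=
        lintegral_const_mul _ ((measurable_eFracMax 0 g).pow_const p)
    _ ≤ A ^ (q / p - 1) * (C * A) := by gcongr; exact h g hg
    _ = C * A ^ (q / p) := by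
        rw [mul_left_comm]
        congr 1
        nth_rewrite 2 [← ENNReal.rpow_one A]
        rw [← ENNReal.rpow_add_of_nonneg _ _ (by rw [sub_nonneg, le_div_iff₀ hp0]; linarith)
          zero_le_one, sub_add_cancel]

end StrongType

/-! ### Averages and Lebesgue differentiation. -/

section Averages

open Metric Filter Topology

variable {n : ℕ}

theorem enorm_setAverage_sub_le {β : Type*} [MeasurableSpace β] {μ : Measure β} {s : Set β}
    (h0 : μ s ≠ 0) (ht : μ s ≠ ∞) {f : β → ℝ} (hf : IntegrableOn f s μ) (m : ℝ) :
    ‖(⨍ y in s, f y ∂μ) - m‖ₑ ≤ (∫⁻ y in s, ‖f y - m‖ₑ ∂μ) / μ s := by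
  have hfin : IsFiniteMeasure (μ.restrict s) := ⟨by rw [Measure.restrict_apply_univ]; exact ht.lt_top⟩
  have hreal : μ.real s ≠ 0 := (ENNReal.toReal_pos h0 ht).ne'
  have heq : (⨍ y in s, f y ∂μ) - m = ⨍ y in s, (f y - m) ∂μ := by
    rw [setAverage_eq, setAverage_eq, integral_sub hf (integrable_const m), setIntegral_const,
      smul_sub, smul_smul, inv_mul_cancel₀ hreal, one_smul]
  rw [heq, average]
  refine (enorm_integral_le_lintegral_enorm _).trans_eq ?_
  rw [lintegral_smul_measure, Measure.restrict_apply_univ, smul_eq_mul, ENNReal.div_eq_inv_mul]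

theorem IsCube.integrableOn {Q : Set (Fin n → ℝ)} (hQ : IsCube Q) {f : (Fin n → ℝ) → ℝ}
    (hf : LocallyIntegrable f volume) : IntegrableOn f Q :=
  hf.integrableOn_isCompact hQ.isCompact

/-- A consequence of Lebesgue's differentiation theorem. -/
theorem ae_exists_lt_setAverage {f : (Fin n → ℝ) → ℝ} (hf : LocallyIntegrable f volume) :
    ∀ᵐ x, ∀ A < f x, ∀ R : ℝ, 0 < R → ∃ r, 0 < r ∧ r ≤ R ∧ A < ⨍ y in closedBall x r, f y := by
  filter_upwards [IsUnifLocDoublingMeasure.ae_tendsto_average volume hf 1] with x hx A hA R hR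
  have h := hx (l := 𝓝[>] (0 : ℝ)) (fun _ => x) (fun r => r) tendsto_id (by
    filter_upwards [self_mem_nhdsWithin] with r hr
    exact mem_closedBall_self (by simpa using le_of_lt hr))
  have h1 : ∀ᶠ r : ℝ in 𝓝[>] 0, r ≤ R :=
    nhdsWithin_le_nhds (eventually_le_nhds hR)
  obtain ⟨r, ⟨hr1, hr2⟩, hr3⟩ := ((h.eventually_const_lt hA).and (h1)).and self_mem_nhdsWithin |>.exists
  exact ⟨r, hr3, hr2, hr1⟩

/-- Supplies the small starting cubes for the stopping argument in the John-Nirenberg inequality. -/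
theorem ae_exists_lt_lintegral_enorm_sub {b : (Fin n → ℝ) → ℝ} (hb : LocallyIntegrable b volume)
    (m : ℝ) (A : ℝ≥0) {R : ℝ} (hR : 0 < R) :
    ∀ᵐ x, A < ‖b x - m‖ₑ → ∃ r, 0 < r ∧ r ≤ R ∧
      A * volume (closedBall x r) < ∫⁻ y in closedBall x r, ‖b y - m‖ₑ := by
  have hf : LocallyIntegrable (fun y => ‖b y - m‖) volume :=
    fun x => ((hb.sub (locallyIntegrable_const m)) x).norm
  filter_upwards [ae_exists_lt_setAverage hf] with x hx hA
  obtain ⟨r, hr0, hrR, hr⟩ := hx A (by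
    rw [← ofReal_norm, ← ENNReal.ofReal_coe_nnreal,
      ENNReal.ofReal_lt_ofReal_iff_of_nonneg A.coe_nonneg] at hA
    exact hA) R hR
  refine ⟨r, hr0, hrR, ?_⟩
  rw [← ENNReal.lt_div_iff_mul_lt (Or.inl (volume_cube_ne_zero x hr0))
    (Or.inl (volume_cube_ne_top x r))]
  simp_rw [← ofReal_norm]
  rw [← ofReal_setAverage ((isCube_closedBall x hr0).integrableOn hf)
    (Eventually.of_forall fun _ => norm_nonneg _), ← ENNReal.ofReal_coe_nnreal,
    ENNReal.ofReal_lt_ofReal_iff_of_nonneg A.coe_nonneg]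
  exact hr

end Averages

/-! ### The John-Nirenberg inequality and its consequence for local maximal functions. -/

section JohnNirenberg

open Metric Filter Topology

variable {n : ℕ}

/-- `b` is locally integrable and its mean oscillation over every cube is at most `K`. -/
def HasOscillationBound (b : (Fin n → ℝ) → ℝ) (K : ℝ≥0) : Prop :=
  LocallyIntegrable b volume ∧
    ∀ Q : Set (Fin n → ℝ), IsCube Q → ∫⁻ x in Q, ‖b x - ⨍ y in Q, b y‖ₑ ≤ K * volume Q

theorem isBMO_iff {b : (Fin n → ℝ) → ℝ} : IsBMO b ↔ ∃ K : ℝ≥0, K ≠ 0 ∧ HasOscillationBound b K := by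
  constructor
  · rintro ⟨hb, h⟩
    obtain ⟨K, hK⟩ := ENNReal.lt_iff_exists_nnreal_btwn.1 h
    -- The added 1 keeps the constant nonzero, so that it can be cancelled later.
    refine ⟨K + 1, by positivity, hb, fun Q hQ => ?_⟩
    have h1 := (le_iSup₂ (f := fun (Q : Set (Fin n → ℝ)) (_ : IsCube Q) =>
      (∫⁻ x in Q, ‖b x - ⨍ y in Q, b y‖ₑ) / volume Q) Q hQ).trans hK.1.le
    rw [ENNReal.div_le_iff hQ.volume_ne_zero hQ.volume_ne_top] at h1
    refine h1.trans ?_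
    gcongr
    simp
  · rintro ⟨K, -, hb, h⟩
    refine ⟨hb, lt_of_le_of_lt (iSup₂_le fun Q hQ => ?_) (ENNReal.coe_lt_top (r := K))⟩
    rw [ENNReal.div_le_iff hQ.volume_ne_zero hQ.volume_ne_top]
    exact h Q hQ

/-- The exponential decay in the John-Nirenberg inequality. -/
theorem HasOscillationBound.volume_superlevel_le {b : (Fin n → ℝ) → ℝ} {K : ℝ≥0}
    (hK : K ≠ 0) (hb : HasOscillationBound b K) (k : ℕ) {Q : Set (Fin n → ℝ)} (hQ : IsCube Q) :
    volume {x ∈ Q | k * ((2 * 10 ^ n * K + 2 ^ n * K : ℝ≥0) : ℝ≥0∞) < ‖b x - ⨍ y in Q, b y‖ₑ}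
      ≤ 2⁻¹ ^ k * volume Q := by
  -- The induction hypothesis is applied to the fivefold enlargements of selected cubes, not to Q
  -- itself.
  induction k generalizing Q with
  | zero => simpa using measure_mono (Set.sep_subset _ _)
  | succ k ih =>
  obtain ⟨c, r, hr, rfl⟩ := isCube_iff.1 hQ
  set A : ℝ≥0 := 2 * 10 ^ n * K with hA
  -- The doubled cube contains every cube with centre in Q and radius at most r, so deviations are
  -- measured from its mean.
  set m := ⨍ y in closedBall c (2 * r), b y with hm
  set g : (Fin n → ℝ) → ℝ≥0∞ := fun y => ‖b y - m‖ₑ with hg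
  set m0 := ⨍ y in closedBall c r, b y with hm0
  have hint : ∀ (x : Fin n → ℝ) (s : ℝ), IntegrableOn b (closedBall x s) := fun x s =>
    hb.1.integrableOn_isCompact (isCompact_closedBall x s)
  have hgB : ∫⁻ y in closedBall c (2 * r), g y ≤ K * (2 ^ n * volume (closedBall c r)) := by
    refine (hb.2 _ (isCube_closedBall c (by positivity))).trans_eq ?_
    rw [volume_cube_mul c c two_pos hr, ENNReal.ofReal_ofNat]
  have hm0m : ‖m0 - m‖ₑ ≤ (2 ^ n * K : ℝ≥0) := by
    refine (enorm_setAverage_sub_le (volume_cube_ne_zero c hr) (volume_cube_ne_top c r)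
      (hint c r) m).trans ?_
    rw [ENNReal.div_le_iff (volume_cube_ne_zero c hr) (volume_cube_ne_top c r)]
    refine ((lintegral_mono_set (closedBall_subset_closedBall (by linarith))).trans hgB).trans_eq ?_
    push_cast
    ring
  set F : Set ((Fin n → ℝ) × ℝ) := {a | a.1 ∈ closedBall c r ∧ 0 < a.2 ∧ a.2 ≤ r ∧
    A * volume (closedBall a.1 a.2) < ∫⁻ y in closedBall a.1 a.2, g y} with hF
  have hsub : ∀ a ∈ F, closedBall a.1 a.2 ⊆ closedBall c (2 * r) := fun a ha =>
    closedBall_subset_closedBall' (by linarith [mem_closedBall.1 ha.1, ha.2.2.1])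
  -- A larger cube would have average at most 10^n K, below the threshold A; hence the fivefold cube
  -- still meets the radius condition.
  have hF5 : ∀ a ∈ F, 5 * a.2 ≤ r := by
    intro a ha
    by_contra! hlt
    have hvol : volume (closedBall c r) ≤ 5 ^ n * volume (closedBall a.1 a.2) := by
      rw [← ENNReal.ofReal_ofNat 5, ← volume_cube_mul a.1 a.1 (by norm_num) ha.2.1, volume_cube c hr,
        volume_cube a.1 (by linarith)]
      gcongr
    refine absurd ha.2.2.2 (not_lt.2 ?_)
    calc ∫⁻ y in closedBall a.1 a.2, g y ≤ K * (2 ^ n * (5 ^ n * volume (closedBall a.1 a.2))) :=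
          (lintegral_mono_set (hsub a ha)).trans (hgB.trans (by gcongr))
      _ = ((10 ^ n * K : ℝ≥0) : ℝ≥0∞) * volume (closedBall a.1 a.2) := by
          push_cast
          rw [show (10 : ℝ≥0∞) = 2 * 5 by norm_num, mul_pow]
          ring
      _ ≤ A * volume (closedBall a.1 a.2) := by
          gcongr
          rw [hA, mul_assoc, two_mul]
          exact le_self_add
  -- Stopping cubes: the average exceeds A, but over the fivefold cube it does not. The factor 5 is
  -- that of Vitali's lemma, so the enlarged cubes cover and their means stay within A of m.
  set t : Set ((Fin n → ℝ) × ℝ) := {a ∈ F | (a.1, 5 * a.2) ∉ F} with ht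
  have htF : t ⊆ F := Set.sep_subset _ _
  have ht5 : ∀ a ∈ t, ‖(⨍ y in closedBall a.1 (5 * a.2), b y) - m‖ₑ ≤ A := by
    intro a ha
    have h0 : 0 < 5 * a.2 := by linarith [ha.1.2.1]
    refine (enorm_setAverage_sub_le (volume_cube_ne_zero a.1 h0) (volume_cube_ne_top _ _)
      (hint _ _) m).trans ?_
    rw [ENNReal.div_le_iff (volume_cube_ne_zero a.1 h0) (volume_cube_ne_top _ _)]
    by_contra! hlt
    exact ha.2 ⟨ha.1.1, h0, hF5 a ha.1, hlt⟩
  have hmaximal : ∀ x s, (x, s) ∈ F → ∃ s', (x, s') ∈ t := by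
    intro x s hs
    by_contra! hcon
    have hall : ∀ j : ℕ, (x, 5 ^ j * s) ∈ F := by
      intro j
      induction j with
      | zero => simpa using hs
      | succ j ihj =>
        by_contra hnot
        exact hcon _ ⟨ihj, by rwa [pow_succ', mul_assoc] at hnot⟩
    obtain ⟨j, hj⟩ := pow_unbounded_of_one_lt (r / s) (by norm_num : (1 : ℝ) < 5)
    have := (hall j).2.2.1
    rw [div_lt_iff₀ hs.2.1] at hj
    linarith
  obtain ⟨u, hut, hu, hd, hcov⟩ := exists_disjoint_cubes t r (fun a ha => ha.1.2.1)
    (fun a ha => ha.1.2.2.1)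
  set T : ℝ≥0 := A + 2 ^ n * K with hT
  -- One unit T pays for both changes of mean: 2^n K from Q to its double, and A from the double to
  -- an enlarged stopping cube. The remaining deviation exceeds k units.
  have hcontain : ∀ᵐ x, x ∈ {x ∈ closedBall c r | ((k + 1 : ℕ) : ℝ≥0∞) * T < ‖b x - m0‖ₑ} →
      x ∈ ⋃ a ∈ u, {x ∈ closedBall a.1 (5 * a.2) |
        k * (T : ℝ≥0∞) < ‖b x - ⨍ y in closedBall a.1 (5 * a.2), b y‖ₑ} := by
    filter_upwards [ae_exists_lt_lintegral_enorm_sub hb.1 m A hr] with x hx hxE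
    have hgx : k * (T : ℝ≥0∞) + A < g x := by
      have h1 : ((k + 1 : ℕ) : ℝ≥0∞) * T < g x + (2 ^ n * K : ℝ≥0) := by
        refine hxE.2.trans_le ?_
        calc ‖b x - m0‖ₑ = ‖(b x - m) + (m - m0)‖ₑ := by rw [sub_add_sub_cancel]
          _ ≤ g x + ‖m - m0‖ₑ := enorm_add_le _ _
          _ ≤ _ := by rw [← enorm_neg (m - m0), neg_sub]; gcongr
      have h2 : ((k + 1 : ℕ) : ℝ≥0∞) * T = (k * (T : ℝ≥0∞) + A) + (2 ^ n * K : ℝ≥0) := by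
        rw [hT]; push_cast; ring
      rw [h2] at h1
      exact lt_of_add_lt_add_right h1
    obtain ⟨s, hs0, hsr, hs⟩ := hx (lt_of_le_of_lt le_add_self hgx)
    obtain ⟨s', hs'⟩ := hmaximal x s ⟨hxE.1, hs0, hsr, hs⟩
    obtain ⟨a, ha, hxa⟩ := hcov _ hs'
    refine Set.mem_biUnion ha ⟨hxa (mem_closedBall_self hs'.1.2.1.le), ?_⟩
    have h3 : k * (T : ℝ≥0∞) + A < ‖b x - ⨍ y in closedBall a.1 (5 * a.2), b y‖ₑ + A := by
      refine hgx.trans_le ?_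
      calc g x = ‖(b x - ⨍ y in closedBall a.1 (5 * a.2), b y) +
            ((⨍ y in closedBall a.1 (5 * a.2), b y) - m)‖ₑ := by rw [sub_add_sub_cancel]
        _ ≤ _ := (enorm_add_le _ _).trans (by gcongr; exact ht5 a (hut ha))
    exact lt_of_add_lt_add_right h3
  -- The factor 2 in A makes the enlarged cubes have at most half the volume of Q in total, which
  -- gives the decay 2^(-k).
  have hsum : 2 * (5 ^ n * ∑' a : u, volume (closedBall a.1.1 a.1.2)) ≤ volume (closedBall c r) := by
    have h1 : A * ∑' a : u, volume (closedBall a.1.1 a.1.2)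
        ≤ K * (2 ^ n * volume (closedBall c r)) := by
      rw [← ENNReal.tsum_mul_left]
      refine (ENNReal.tsum_le_tsum fun a => (htF (hut a.2)).2.2.2.le).trans ?_
      exact (tsum_lintegral_le hu hd _ (fun a ha => hsub a (htF (hut ha))) g).trans hgB
    have h2 : (A : ℝ≥0∞) = (K * 2 ^ n : ℝ≥0) * (2 * 5 ^ n) := by
      rw [hA]
      push_cast
      rw [show (10 : ℝ≥0∞) = 2 * 5 by norm_num, mul_pow]
      ring
    have h3 : (K : ℝ≥0∞) * (2 ^ n * volume (closedBall c r))
        = (K * 2 ^ n : ℝ≥0) * volume (closedBall c r) := by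
      push_cast
      ring
    rw [h2, h3, mul_assoc, ENNReal.mul_le_mul_iff_right (by simpa using hK) ENNReal.coe_ne_top,
      mul_assoc] at h1
    exact h1
  calc volume {x ∈ closedBall c r | ((k + 1 : ℕ) : ℝ≥0∞) * T < ‖b x - m0‖ₑ}
      ≤ volume (⋃ a ∈ u, {x ∈ closedBall a.1 (5 * a.2) |
        k * (T : ℝ≥0∞) < ‖b x - ⨍ y in closedBall a.1 (5 * a.2), b y‖ₑ}) := measure_mono_ae hcontain
    _ ≤ ∑' a : u, volume {x ∈ closedBall a.1.1 (5 * a.1.2) |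
        k * (T : ℝ≥0∞) < ‖b x - ⨍ y in closedBall a.1.1 (5 * a.1.2), b y‖ₑ} :=
        measure_biUnion_le volume hu _
    _ ≤ ∑' a : u, 2⁻¹ ^ k * (5 ^ n * volume (closedBall a.1.1 a.1.2)) := by
        refine ENNReal.tsum_le_tsum fun a => ?_
        have h0 : 0 < a.1.2 := (hut a.2).1.2.1
        refine (ih (isCube_closedBall a.1.1 (by linarith : 0 < 5 * a.1.2))).trans_eq ?_
        rw [volume_cube_mul a.1.1 a.1.1 (by norm_num) h0, ENNReal.ofReal_ofNat]
    _ = 2⁻¹ ^ (k + 1) * (2 * (5 ^ n * ∑' a : u, volume (closedBall a.1.1 a.1.2))) := by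
        rw [ENNReal.tsum_mul_left, ENNReal.tsum_mul_left, pow_succ, mul_assoc (2⁻¹ ^ k),
          ← mul_assoc 2⁻¹ 2, ENNReal.inv_mul_cancel (by simp) (by simp), one_mul]
    _ ≤ 2⁻¹ ^ (k + 1) * volume (closedBall c r) := by gcongr

/-- Exponential decay beats polynomial growth; s is rounded up to a natural exponent. -/
theorem tsum_rpow_mul_geometric_ne_top (T : ℝ≥0) {s : ℝ} (hs : 0 < s) :
    ∑' k : ℕ, ((k + 1 : ℕ) * (T : ℝ≥0∞)) ^ s * 2⁻¹ ^ k ≠ ∞ := by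
  have h1 : Summable fun k : ℕ => ((k + 1 : ℕ) : ℝ) ^ ⌈s⌉₊ * (2⁻¹ : ℝ) ^ (k + 1) :=
    (summable_nat_add_iff (f := fun k : ℕ => ((k : ℕ) : ℝ) ^ ⌈s⌉₊ * (2⁻¹ : ℝ) ^ k) 1).2
      (summable_pow_mul_geometric_of_norm_lt_one _ (by norm_num))
  have h2 := h1.tsum_ofReal_ne_top
  refine ne_top_of_le_ne_top (ENNReal.mul_ne_top (a := (T : ℝ≥0∞) ^ s * 2)
    (ENNReal.mul_ne_top (ENNReal.rpow_ne_top_of_nonneg hs.le ENNReal.coe_ne_top) (by simp)) h2) ?_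
  rw [← ENNReal.tsum_mul_left]
  refine ENNReal.tsum_le_tsum fun k => ?_
  rw [ENNReal.ofReal_mul (by positivity), ENNReal.ofReal_pow (by positivity),
    ENNReal.ofReal_pow (by positivity), ENNReal.ofReal_natCast, ENNReal.ofReal_inv_of_pos two_pos,
    ENNReal.ofReal_ofNat, ENNReal.mul_rpow_of_nonneg _ _ hs.le, pow_succ 2⁻¹ k]
  have h3 : ((k + 1 : ℕ) : ℝ≥0∞) ^ s ≤ ((k + 1 : ℕ) : ℝ≥0∞) ^ ⌈s⌉₊ := by
    rw [← ENNReal.rpow_natCast]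
    exact ENNReal.rpow_le_rpow_of_exponent_le (by simp) (Nat.le_ceil s)
  calc ((k + 1 : ℕ) : ℝ≥0∞) ^ s * (T : ℝ≥0∞) ^ s * 2⁻¹ ^ k
      ≤ ((k + 1 : ℕ) : ℝ≥0∞) ^ ⌈s⌉₊ * (T : ℝ≥0∞) ^ s * 2⁻¹ ^ k := by gcongr
    _ = ((k + 1 : ℕ) : ℝ≥0∞) ^ ⌈s⌉₊ * (T : ℝ≥0∞) ^ s * 2⁻¹ ^ k * (2 * 2⁻¹) := by
        rw [ENNReal.mul_inv_cancel (by simp) (by simp), mul_one]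
    _ = _ := by ring

theorem rpow_le_tsum_of_ne_top {T : ℝ≥0} (hT : T ≠ 0) {s : ℝ} (hs : 0 < s) {y : ℝ≥0∞} (hy : y ≠ ∞) :
    y ^ s ≤ ∑' k : ℕ, if k * (T : ℝ≥0∞) < y then ((k + 1 : ℕ) * (T : ℝ≥0∞)) ^ s else 0 := by
  rcases eq_or_ne y 0 with rfl | h0
  · simp [hs]
  lift y to ℝ≥0 using hy
  have hy0 : 0 < y := pos_iff_ne_zero.2 (by simpa using h0)
  have hT0 : 0 < T := pos_iff_ne_zero.2 hT
  have hc : 0 < ⌈y / T⌉₊ := Nat.ceil_pos.2 (div_pos hy0 hT0)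
  -- With k = ⌈y/T⌉ - 1 one has kT < y ≤ (k+1)T, and this single term dominates.
  obtain ⟨k, hk⟩ := Nat.exists_eq_succ_of_ne_zero hc.ne'
  have h1 : (k : ℝ≥0) * T < y := by
    rw [← lt_div_iff₀ hT0]
    exact Nat.lt_ceil.1 (by omega)
  have h2 : y ≤ ((k + 1 : ℕ) : ℝ≥0) * T := by
    rw [← div_le_iff₀ hT0]
    exact (Nat.le_ceil _).trans (by rw [hk])
  refine le_trans ?_ (ENNReal.le_tsum k)
  rw [if_pos (by exact_mod_cast h1)]
  refine ENNReal.rpow_le_rpow ?_ hs.le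
  exact_mod_cast h2

/-- The John-Nirenberg inequality for moments. -/
theorem HasOscillationBound.exists_lintegral_rpow_le {b : (Fin n → ℝ) → ℝ} {K : ℝ≥0}
    (hK : K ≠ 0) (hb : HasOscillationBound b K) {s : ℝ} (hs : 0 < s) :
    ∃ C : ℝ≥0∞, C ≠ ∞ ∧ ∀ Q : Set (Fin n → ℝ), IsCube Q →
      ∫⁻ x in Q, ‖b x - ⨍ y in Q, b y‖ₑ ^ s ≤ C * volume Q := by
  set T : ℝ≥0 := 2 * 10 ^ n * K + 2 ^ n * K with hT
  have hT0 : T ≠ 0 := by positivity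
  refine ⟨_, tsum_rpow_mul_geometric_ne_top T hs, fun Q hQ => ?_⟩
  set g : (Fin n → ℝ) → ℝ≥0∞ := fun x => ‖b x - ⨍ y in Q, b y‖ₑ with hg
  have hgm : AEMeasurable g (volume.restrict Q) :=
    ((hb.1.aestronglyMeasurable.aemeasurable.sub_const _).enorm).restrict
  have hS : ∀ k : ℕ, NullMeasurableSet {x | k * (T : ℝ≥0∞) < g x} (volume.restrict Q) := fun k =>
    nullMeasurableSet_lt aemeasurable_const hgm
  calc ∫⁻ x in Q, g x ^ s
      ≤ ∫⁻ x in Q, ∑' k : ℕ, {x | k * (T : ℝ≥0∞) < g x}.indicator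
        (fun _ => ((k + 1 : ℕ) * (T : ℝ≥0∞)) ^ s) x := by
        refine lintegral_mono fun x => (rpow_le_tsum_of_ne_top hT0 hs enorm_ne_top).trans_eq ?_
        simp [Set.indicator, hg]
    _ = ∑' k : ℕ, ((k + 1 : ℕ) * (T : ℝ≥0∞)) ^ s * volume {x ∈ Q | k * (T : ℝ≥0∞) < g x} := by
        rw [lintegral_tsum fun k => aemeasurable_const.indicator₀ (hS k)]
        refine tsum_congr fun k => ?_
        rw [lintegral_indicator_const₀ (hS k), Measure.restrict_apply₀ (hS k), Set.inter_comm]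
        rfl
    _ ≤ ∑' k : ℕ, ((k + 1 : ℕ) * (T : ℝ≥0∞)) ^ s * (2⁻¹ ^ k * volume Q) := by
        refine ENNReal.tsum_le_tsum fun k => ?_
        gcongr
        exact hb.volume_superlevel_le hK k hQ
    _ = _ := by
        rw [← ENNReal.tsum_mul_right]
        exact tsum_congr fun k => (mul_assoc _ _ _).symm

/-- The deviation of `b` from its average over `Q`, plus the maximal function of this deviation
localized to `Q`. -/
noncomputable def maxDeviation (b : (Fin n → ℝ) → ℝ) (Q : Set (Fin n → ℝ)) (x : Fin n → ℝ) : ℝ≥0∞ :=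
  ‖b x - ⨍ y in Q, b y‖ₑ + eFracMax 0 (Q.indicator fun x => ‖b x - ⨍ y in Q, b y‖ₑ) x

theorem aemeasurable_maxDeviation {b : (Fin n → ℝ) → ℝ} (hb : LocallyIntegrable b volume)
    (Q : Set (Fin n → ℝ)) : AEMeasurable (maxDeviation b Q) :=
  (hb.aestronglyMeasurable.aemeasurable.sub_const _).enorm.add
    (measurable_eFracMax 0 _).aemeasurable

/-- John-Nirenberg bounds the deviation itself; the strong type bound, valid for q > 1, transfers
this to the maximal function of the deviation cut off to Q. -/
theorem HasOscillationBound.exists_lintegral_maxDeviation_le (hn : n ≠ 0) {b : (Fin n → ℝ) → ℝ}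
    {K : ℝ≥0} (hK : K ≠ 0) (hb : HasOscillationBound b K) {q : ℝ} (hq : 1 < q) :
    ∃ C : ℝ≥0∞, C ≠ ∞ ∧ ∀ Q : Set (Fin n → ℝ), IsCube Q →
      ∫⁻ x in Q, maxDeviation b Q x ^ q ≤ C * volume Q := by
  obtain ⟨C₁, hC₁, h₁⟩ := hb.exists_lintegral_rpow_le hK (s := q) (by linarith)
  obtain ⟨C₂, hC₂, h₂⟩ := exists_strong_type_eFracMax_zero hn hq
  have h2 : (2 : ℝ≥0∞) ^ (q - 1) ≠ ∞ := ENNReal.rpow_ne_top_of_nonneg (by linarith) (by simp)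
  refine ⟨2 ^ (q - 1) * (C₁ + C₂ * C₁), ENNReal.mul_ne_top h2
    (ENNReal.add_ne_top.2 ⟨hC₁, ENNReal.mul_ne_top hC₂ hC₁⟩), fun Q hQ => ?_⟩
  have hgm : AEMeasurable fun x => ‖b x - ⨍ y in Q, b y‖ₑ :=
    (hb.1.aestronglyMeasurable.aemeasurable.sub_const _).enorm
  have hM : ∫⁻ x in Q, eFracMax 0 (Q.indicator fun x => ‖b x - ⨍ y in Q, b y‖ₑ) x ^ q
      ≤ C₂ * (C₁ * volume Q) := by
    refine (setLIntegral_le_lintegral _ _).trans ((h₂ _ (hgm.indicator hQ.measurableSet)).trans ?_)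
    gcongr
    refine le_trans (le_of_eq ?_) (h₁ Q hQ)
    rw [← lintegral_indicator hQ.measurableSet]
    refine lintegral_congr fun x => ?_
    by_cases hx : x ∈ Q
    · simp [hx]
    · simp [hx, lt_trans zero_lt_one hq]
  calc ∫⁻ x in Q, maxDeviation b Q x ^ q
      ≤ 2 ^ (q - 1) * ((∫⁻ x in Q, ‖b x - ⨍ y in Q, b y‖ₑ ^ q) +
        ∫⁻ x in Q, eFracMax 0 (Q.indicator fun x => ‖b x - ⨍ y in Q, b y‖ₑ) x ^ q) :=
        lintegral_add_rpow_le hq.le _ (measurable_eFracMax 0 _).aemeasurable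
    _ ≤ 2 ^ (q - 1) * (C₁ * volume Q + C₂ * (C₁ * volume Q)) := by
        gcongr
        exact h₁ Q hQ
    _ = _ := by ring

end JohnNirenberg

/-! ### The maximal commutator of a BMO function. -/

section CommutatorBound

open Metric Filter Topology

variable {n : ℕ}

/-- Hölder's inequality. It bounds the volume of a cube on which the fractional average is large,
which Vitali's lemma needs. -/
theorem IsCube.setLIntegral_div_le {α p q : ℝ} (hp : 1 ≤ p) (hα : 1 / q = 1 / p - α / n)
    {g : (Fin n → ℝ) → ℝ≥0∞} (hg : AEMeasurable g) {Q : Set (Fin n → ℝ)} (hQ : IsCube Q) :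
    (∫⁻ y in Q, g y) / volume Q ^ (1 - α / n)
      ≤ (∫⁻ y, g y ^ p) ^ (1 / p) / volume Q ^ (1 / q) := by
  have hV0 := hQ.volume_ne_zero
  have hVt := hQ.volume_ne_top
  have h1 : ∫⁻ y in Q, g y ≤ (∫⁻ y, g y ^ p) ^ (1 / p) * volume Q ^ (1 - 1 / p) := by
    refine (lintegral_le_rpow_mul_measure_univ hp hg.restrict).trans ?_
    rw [Measure.restrict_apply_univ]
    exact mul_le_mul_left (ENNReal.rpow_le_rpow (setLIntegral_le_lintegral _ _) (by positivity)) _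
  refine (ENNReal.div_le_div_right h1 _).trans_eq ?_
  rw [mul_div_assoc, ← ENNReal.rpow_sub _ _ hV0 hVt, div_eq_mul_inv _ (volume Q ^ (1 / q)),
    ← ENNReal.rpow_neg]
  congr 2
  linarith

/-- Replacing the mean over Q by that over Q' costs at most the average over Q of the deviation from
the latter, hence at most its maximal function at x. The resulting bound no longer depends on Q. -/
theorem enorm_sub_average_le_maxDeviation {b : (Fin n → ℝ) → ℝ}
    (hb : LocallyIntegrable b volume) {Q Q' : Set (Fin n → ℝ)} (hQ : IsCube Q) (hsub : Q ⊆ Q')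
    {x : Fin n → ℝ} (hx : x ∈ Q) : ‖b x - ⨍ y in Q, b y‖ₑ ≤ maxDeviation b Q' x := by
  set m := ⨍ y in Q', b y with hm
  calc ‖b x - ⨍ y in Q, b y‖ₑ = ‖(b x - m) - ((⨍ y in Q, b y) - m)‖ₑ := by rw [sub_sub_sub_cancel_right]
    _ ≤ ‖b x - m‖ₑ + ‖(⨍ y in Q, b y) - m‖ₑ := enorm_sub_le
    _ ≤ _ := by
      refine add_le_add le_rfl ?_
      refine (enorm_setAverage_sub_le hQ.volume_ne_zero hQ.volume_ne_top
        (hQ.integrableOn hb) m).trans ?_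
      refine le_trans (le_of_eq ?_) (average_le_eFracMax hQ hx)
      congr 1
      refine setLIntegral_congr_fun hQ.measurableSet fun y hy => ?_
      simp [Set.indicator_of_mem (hsub hy), hm]

/-- The part of the maximal commutator in which the deviation is taken at the point `x`. It is
bounded by decomposing the cubes according to the size of the fractional average of `g`. -/
theorem HasOscillationBound.exists_majorant_pointwise_part (hn : n ≠ 0) {b : (Fin n → ℝ) → ℝ}
    {K : ℝ≥0} (hK : K ≠ 0) (hb : HasOscillationBound b K) {α p q : ℝ} (hp : 1 < p) (hpq : p ≤ q)
    (hα : 1 / q = 1 / p - α / n) :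
    ∃ C : ℝ≥0∞, C ≠ ∞ ∧ ∀ g : (Fin n → ℝ) → ℝ≥0∞, AEMeasurable g → ∫⁻ x, g x ^ p ≠ ∞ →
      ∃ H : (Fin n → ℝ) → ℝ≥0∞, AEMeasurable H ∧
        (∀ Q : Set (Fin n → ℝ), IsCube Q → ∀ x ∈ Q,
          ‖b x - ⨍ y in Q, b y‖ₑ * ((∫⁻ y in Q, g y) / volume Q ^ (1 - α / n)) ≤ H x) ∧
        ∫⁻ x, H x ^ q ≤ C * (∫⁻ x, g x ^ p) ^ (q / p) := by
  have hp0 : 0 < p := by linarith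
  have hq1 : 1 < q := by linarith
  have hq0 : 0 < q := by linarith
  obtain ⟨C₁, hC₁, h₁⟩ := hb.exists_lintegral_maxDeviation_le hn hK hq1
  obtain ⟨C₂, hC₂, h₂⟩ := exists_dyadic_sum_le_lintegral hq0
  obtain ⟨C₃, hC₃, h₃⟩ := exists_strong_type_eFracMax hn hp hpq hα
  have h2q : (2 : ℝ≥0∞) ^ q ≠ ∞ := ENNReal.rpow_ne_top_of_nonneg hq0.le (by simp)
  refine ⟨2 ^ q * (C₁ * 5 ^ n) * (C₂ * C₃), ENNReal.mul_ne_top (ENNReal.mul_ne_top h2q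
    (ENNReal.mul_ne_top hC₁ (by simp))) (ENNReal.mul_ne_top hC₂ hC₃), fun g hg hgp => ?_⟩
  set N := (∫⁻ y, g y ^ p) ^ (1 / p) with hN
  have hNt : N ≠ ∞ := ENNReal.rpow_ne_top_of_nonneg (by positivity) hgp
  set av : Set (Fin n → ℝ) → ℝ≥0∞ := fun Q => (∫⁻ y in Q, g y) / volume Q ^ (1 - α / n) with hav
  have h2k : ∀ k : ℤ, (2 : ℝ≥0∞) ^ k ≠ 0 ∧ (2 : ℝ≥0∞) ^ k ≠ ∞ := fun k =>
    ⟨(ENNReal.zpow_pos (by simp) (by simp) k).ne', (ENNReal.zpow_lt_top (by simp) (by simp) k).ne⟩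
  set F : ℤ → Set ((Fin n → ℝ) × ℝ) := fun k =>
    {a | 0 < a.2 ∧ (2 : ℝ≥0∞) ^ k < av (closedBall a.1 a.2)} with hF
  have hFvol : ∀ k, ∀ a ∈ F k, volume (closedBall a.1 a.2) ≤ (N / 2 ^ k) ^ q := by
    intro k a ha
    have hQ := isCube_closedBall a.1 ha.1
    have h := (ha.2.trans_le (hQ.setLIntegral_div_le hp.le hα hg)).le
    rw [ENNReal.le_div_iff_mul_le (by simp [ENNReal.rpow_eq_zero_iff, hQ.volume_ne_zero, hQ.volume_ne_top])
      (by simp [ENNReal.rpow_eq_top_iff, hQ.volume_ne_zero, hQ.volume_ne_top]), mul_comm,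
      ← ENNReal.le_div_iff_mul_le (Or.inl (h2k k).1) (Or.inl (h2k k).2)] at h
    calc volume (closedBall a.1 a.2) = (volume (closedBall a.1 a.2) ^ (1 / q)) ^ q := by
          rw [← ENNReal.rpow_mul, one_div_mul_cancel hq0.ne', ENNReal.rpow_one]
      _ ≤ _ := ENNReal.rpow_le_rpow h hq0.le
  have hex : ∀ k, ∃ u ⊆ F k, u.Countable ∧ u.PairwiseDisjoint (fun a => closedBall a.1 a.2) ∧
      ∀ a ∈ F k, ∃ a' ∈ u, closedBall a.1 a.2 ⊆ closedBall a'.1 (5 * a'.2) := fun k => by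
    obtain ⟨R, hR⟩ := exists_radius_bound hn (V := (N / 2 ^ k) ^ q)
      (ENNReal.rpow_ne_top_of_nonneg hq0.le (ENNReal.div_ne_top hNt (h2k k).1))
    exact exists_disjoint_cubes (F k) R (fun a ha => ha.1)
      fun a ha => hR a.1 a.2 ha.1 (hFvol k a ha)
  choose u huF hu hd hcov using hex
  have : ∀ k, Countable (u k) := fun k => (hu k).to_subtype
  set B5 : (Fin n → ℝ) × ℝ → Set (Fin n → ℝ) := fun a => closedBall a.1 (5 * a.2) with hB5
  -- A cube with average in (2^k, 2^(k+1)] lies in some fivefold cube chosen at level k, where its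
  -- contribution is at most 2^(k+1) times the deviation of that cube. Summing q-th powers over all
  -- levels and chosen cubes majorizes the supremum.
  set φ : (k : ℤ) → u k → (Fin n → ℝ) → ℝ≥0∞ := fun k a =>
    (B5 a.1).indicator fun x => ((2 : ℝ≥0∞) ^ (k + 1)) ^ q * maxDeviation b (B5 a.1) x ^ q with hφ
  have hφm : ∀ k a, AEMeasurable (φ k a) := fun k a =>
    (((aemeasurable_maxDeviation hb.1 (B5 a.1)).pow_const q).const_mul _).indicator
      measurableSet_closedBall
  have hSm : AEMeasurable fun x => ∑' k, ∑' a, φ k a x :=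
    AEMeasurable.tsum fun k => AEMeasurable.tsum fun a => hφm k a
  refine ⟨fun x => (∑' k, ∑' a, φ k a x) ^ (1 / q), hSm.pow_const _, fun Q hQ x hx => ?_, ?_⟩
  · change _ * av Q ≤ _
    rcases eq_or_ne (av Q) 0 with h0 | h0
    · rw [h0, mul_zero]; exact zero_le
    have ht : av Q ≠ ∞ := by
      refine ne_top_of_le_ne_top (ENNReal.div_ne_top hNt ?_) (hQ.setLIntegral_div_le hp.le hα hg)
      simp [ENNReal.rpow_eq_zero_iff, hQ.volume_ne_zero, hQ.volume_ne_top]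
    obtain ⟨k, hk1, hk2⟩ := ENNReal.exists_mem_Ioc_zpow h0 ht (y := 2) (by norm_num) (by simp)
    obtain ⟨c, r, hr, rfl⟩ := isCube_iff.1 hQ
    obtain ⟨a, ha, hsub⟩ := hcov k (c, r) ⟨hr, hk1⟩
    have hdev := enorm_sub_average_le_maxDeviation hb.1 hQ hsub hx
    calc ‖b x - ⨍ y in closedBall c r, b y‖ₑ * av (closedBall c r)
        ≤ maxDeviation b (B5 a) x * 2 ^ (k + 1) := mul_le_mul' hdev hk2
      _ = (φ k ⟨a, ha⟩ x) ^ (1 / q) := by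
          rw [hφ]
          simp only
          rw [Set.indicator_of_mem (hsub hx), ← ENNReal.mul_rpow_of_nonneg _ _ hq0.le,
            ← ENNReal.rpow_mul, mul_one_div_cancel hq0.ne', ENNReal.rpow_one, mul_comm]
      _ ≤ _ := by
          refine ENNReal.rpow_le_rpow ?_ (by positivity)
          exact (ENNReal.le_tsum (f := fun a => φ k a x) ⟨a, ha⟩).trans
            (ENNReal.le_tsum (f := fun k => ∑' a, φ k a x) k)
  · have hterm : ∀ k (a : u k), ∫⁻ x, φ k a x
        ≤ 2 ^ q * (C₁ * 5 ^ n) * (((2 : ℝ≥0∞) ^ k) ^ q * volume (closedBall a.1.1 a.1.2)) := by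
      intro k a
      have h0 : 0 < a.1.2 := (huF k a.2).1
      rw [hφ]
      simp only
      rw [lintegral_indicator measurableSet_closedBall, lintegral_const_mul' _ _
        (ENNReal.rpow_ne_top_of_nonneg hq0.le (h2k _).2)]
      refine (mul_le_mul_right (h₁ (B5 a.1) (isCube_closedBall a.1.1
        (by linarith : 0 < 5 * a.1.2))) _).trans_eq ?_
      rw [hB5]
      simp only
      rw [volume_cube_mul a.1.1 a.1.1 (by norm_num) h0, ENNReal.ofReal_ofNat,
        ENNReal.zpow_add (by simp) (by simp), zpow_one, ENNReal.mul_rpow_of_nonneg _ _ hq0.le]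
      ring
    calc ∫⁻ x, ((∑' k, ∑' a, φ k a x) ^ (1 / q)) ^ q = ∫⁻ x, ∑' k, ∑' a, φ k a x := by
          refine lintegral_congr fun x => ?_
          rw [← ENNReal.rpow_mul, one_div_mul_cancel hq0.ne', ENNReal.rpow_one]
      _ = ∑' k, ∑' a, ∫⁻ x, φ k a x := by
          rw [lintegral_tsum fun k => AEMeasurable.tsum fun a => hφm k a]
          exact tsum_congr fun k => lintegral_tsum fun a => hφm k a
      _ ≤ ∑' k, ∑' a : u k, 2 ^ q * (C₁ * 5 ^ n) *
          (((2 : ℝ≥0∞) ^ k) ^ q * volume (closedBall a.1.1 a.1.2)) :=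
          ENNReal.tsum_le_tsum fun k => ENNReal.tsum_le_tsum fun a => hterm k a
      _ = 2 ^ q * (C₁ * 5 ^ n) * ∑' k : ℤ, ((2 : ℝ≥0∞) ^ k) ^ q *
          ∑' a : u k, volume (closedBall a.1.1 a.1.2) := by
          simp_rw [ENNReal.tsum_mul_left]
      _ ≤ 2 ^ q * (C₁ * 5 ^ n) * ∑' k : ℤ, ((2 : ℝ≥0∞) ^ k) ^ q *
          volume {x | (2 : ℝ≥0∞) ^ k < eFracMax α g x} := by
          refine mul_le_mul_right (ENNReal.tsum_le_tsum fun k => mul_le_mul_right ?_ _) _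
          -- The chosen cubes of level k are disjoint and lie in the superlevel set of the
          -- fractional maximal function at 2^k.
          refine tsum_volume_le (hu k) (hd k) _ fun a ha x hx => ?_
          exact (huF k ha).2.trans_le (le_eFracMax (isCube_closedBall a.1 (huF k ha).1) hx)
      _ ≤ 2 ^ q * (C₁ * 5 ^ n) * (C₂ * (C₃ * (∫⁻ x, g x ^ p) ^ (q / p))) := by
          gcongr
          exact (h₂ volume _ (measurable_eFracMax α g)).trans (mul_le_mul_right (h₃ g hg) _)
      _ = _ := by ring

/-- The part of the maximal commutator in which the deviation is taken under the integral. -/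
theorem HasOscillationBound.exists_majorant_integral_part (hn : n ≠ 0) {b : (Fin n → ℝ) → ℝ}
    {K : ℝ≥0} (hK : K ≠ 0) (hb : HasOscillationBound b K) {α p q : ℝ} (hp : 1 < p) (hpq : p ≤ q)
    (hα : 1 / q = 1 / p - α / n) :
    ∃ C : ℝ≥0∞, C ≠ ∞ ∧ ∀ g : (Fin n → ℝ) → ℝ≥0∞, AEMeasurable g →
      ∃ H : (Fin n → ℝ) → ℝ≥0∞, AEMeasurable H ∧
        (∀ Q : Set (Fin n → ℝ), IsCube Q → ∀ x ∈ Q,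
          (∫⁻ y in Q, ‖b y - ⨍ z in Q, b z‖ₑ * g y) / volume Q ^ (1 - α / n) ≤ H x) ∧
        ∫⁻ x, H x ^ q ≤ C * (∫⁻ x, g x ^ p) ^ (q / p) := by
  -- Hölder with exponent r puts g^r under the integral, with order αr; since r < p, the strong type
  -- bound applies from L^(p/r) to L^(q/r), the exponent relation being scaled by r.
  obtain ⟨r, hr1, hrp⟩ := exists_between hp
  have hr0 : 0 < r := by linarith
  have hp0 : 0 < p := by linarith
  have hq0 : 0 < q := by linarith
  have hconj := (Real.HolderConjugate.conjExponent hr1).symm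
  set r' := Real.conjExponent r with hr'
  have hr'0 : 0 < r' := hconj.pos
  obtain ⟨C₁, hC₁, h₁⟩ := hb.exists_lintegral_rpow_le hK hr'0
  obtain ⟨C₂, hC₂, h₂⟩ := exists_strong_type_eFracMax hn (α := α * r) (p := p / r) (q := q / r)
    ((one_lt_div hr0).2 hrp) (by gcongr) (by
      rw [one_div_div, one_div_div, mul_comm α, mul_div_assoc, div_eq_mul_one_div, hα]
      ring)
  set D := C₁ ^ (1 / r') with hD
  have hDt : D ≠ ∞ := ENNReal.rpow_ne_top_of_nonneg (by positivity) hC₁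
  refine ⟨D ^ q * C₂, ENNReal.mul_ne_top (ENNReal.rpow_ne_top_of_nonneg hq0.le hDt) hC₂,
    fun g hg => ?_⟩
  have hMm := measurable_eFracMax (α * r) fun y => g y ^ r
  refine ⟨fun x => D * eFracMax (α * r) (fun y => g y ^ r) x ^ (1 / r),
    ((hMm.pow_const _).const_mul D).aemeasurable, fun Q hQ x hx => ?_, ?_⟩
  · have hV0 := hQ.volume_ne_zero
    have hVt := hQ.volume_ne_top
    have hbm : AEMeasurable (fun y => ‖b y - ⨍ z in Q, b z‖ₑ) (volume.restrict Q) :=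
      ((hb.1.aestronglyMeasurable.aemeasurable.sub_const _).enorm).restrict
    have hH := ENNReal.lintegral_mul_le_Lp_mul_Lq (volume.restrict Q) hconj hbm hg.restrict
    have hexp : volume Q ^ (1 / r') / volume Q ^ (1 - α / n)
        = ((volume Q ^ (1 - α * r / n)) ^ (1 / r))⁻¹ := by
      rw [← ENNReal.rpow_mul, ← ENNReal.rpow_neg, ← ENNReal.rpow_sub _ _ hV0 hVt]
      congr 1
      have h := hconj.inv_add_inv_eq_one
      rw [one_div, eq_sub_of_add_eq h]
      field_simp
      ring
    calc (∫⁻ y in Q, ‖b y - ⨍ z in Q, b z‖ₑ * g y) / volume Q ^ (1 - α / n)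
        ≤ ((C₁ * volume Q) ^ (1 / r') * (∫⁻ y in Q, g y ^ r) ^ (1 / r)) / volume Q ^ (1 - α / n) := by
          refine ENNReal.div_le_div_right (hH.trans ?_) _
          gcongr
          exact h₁ Q hQ
      _ = D * ((∫⁻ y in Q, g y ^ r) ^ (1 / r) *
          (volume Q ^ (1 / r') / volume Q ^ (1 - α / n))) := by
          rw [ENNReal.mul_rpow_of_nonneg _ _ (by positivity : 0 ≤ 1 / r'), div_eq_mul_inv,
            div_eq_mul_inv (volume Q ^ (1 / r'))]
          ring
      _ = D * ((∫⁻ y in Q, g y ^ r) / volume Q ^ (1 - α * r / n)) ^ (1 / r) := by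
          rw [hexp, ENNReal.div_rpow_of_nonneg _ _ (by positivity), div_eq_mul_inv (_ ^ (1 / r))]
      _ ≤ _ := mul_le_mul_right (ENNReal.rpow_le_rpow (le_eFracMax hQ hx) (by positivity)) _
  · calc ∫⁻ x, (D * eFracMax (α * r) (fun y => g y ^ r) x ^ (1 / r)) ^ q
        = D ^ q * ∫⁻ x, eFracMax (α * r) (fun y => g y ^ r) x ^ (q / r) := by
          rw [← lintegral_const_mul _ (hMm.pow_const _)]
          refine lintegral_congr fun x => ?_
          rw [ENNReal.mul_rpow_of_nonneg _ _ hq0.le, ← ENNReal.rpow_mul (eFracMax _ _ _),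
            one_div_mul_eq_div]
      _ ≤ D ^ q * (C₂ * (∫⁻ x, (g x ^ r) ^ (p / r)) ^ (q / r / (p / r))) := by
          gcongr
          exact h₂ _ (hg.pow_const r)
      _ = _ := by
          rw [div_div_div_cancel_right₀ hr0.ne', ← mul_assoc]
          simp_rw [← ENNReal.rpow_mul, mul_div_cancel₀ _ hr0.ne']

/-- The maximal commutator of a function of bounded mean oscillation has a majorant with the
`L^p` to `L^q` bounds of the fractional maximal function. -/
theorem HasOscillationBound.exists_majorant (hn : n ≠ 0) {b : (Fin n → ℝ) → ℝ}
    {K : ℝ≥0} (hK : K ≠ 0) (hb : HasOscillationBound b K) {α p q : ℝ} (hp : 1 < p) (hpq : p ≤ q)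
    (hα : 1 / q = 1 / p - α / n) :
    ∃ C : ℝ≥0∞, C ≠ ∞ ∧ ∀ g : (Fin n → ℝ) → ℝ≥0∞, AEMeasurable g → ∫⁻ x, g x ^ p ≠ ∞ →
      ∃ H : (Fin n → ℝ) → ℝ≥0∞, AEMeasurable H ∧
        (∀ Q : Set (Fin n → ℝ), IsCube Q → ∀ x ∈ Q,
          (∫⁻ y in Q, ‖b x - b y‖ₑ * g y) / volume Q ^ (1 - α / n) ≤ H x) ∧
        ∫⁻ x, H x ^ q ≤ C * (∫⁻ x, g x ^ p) ^ (q / p) := by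
  obtain ⟨C₁, hC₁, h₁⟩ := hb.exists_majorant_pointwise_part hn hK hp hpq hα
  obtain ⟨C₂, hC₂, h₂⟩ := hb.exists_majorant_integral_part hn hK hp hpq hα
  have h2 : (2 : ℝ≥0∞) ^ (q - 1) ≠ ∞ := ENNReal.rpow_ne_top_of_nonneg (by linarith) (by simp)
  refine ⟨2 ^ (q - 1) * (C₁ + C₂), ENNReal.mul_ne_top h2 (ENNReal.add_ne_top.2 ⟨hC₁, hC₂⟩),
    fun g hg hgp => ?_⟩
  obtain ⟨H₁, hm₁, hp₁, hi₁⟩ := h₁ g hg hgp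
  obtain ⟨H₂, hm₂, hp₂, hi₂⟩ := h₂ g hg
  refine ⟨fun x => H₁ x + H₂ x, hm₁.add hm₂, fun Q hQ x hx => ?_, ?_⟩
  · refine le_trans ?_ (add_le_add (hp₁ Q hQ x hx) (hp₂ Q hQ x hx))
    rw [← mul_div_assoc, ENNReal.div_add_div_same]
    refine ENNReal.div_le_div_right ?_ _
    rw [← lintegral_const_mul' _ _ enorm_ne_top,
      ← lintegral_add_left' (hg.restrict.const_mul _)]
    refine lintegral_mono fun y => ?_
    rw [← add_mul]
    gcongr
    rw [← sub_sub_sub_cancel_right (b x) (b y) (⨍ z in Q, b z)]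
    exact enorm_sub_le
  · refine (lintegral_add_rpow_le (by linarith) _ hm₂).trans ?_
    calc 2 ^ (q - 1) * ((∫⁻ x, H₁ x ^ q) + ∫⁻ x, H₂ x ^ q)
        ≤ 2 ^ (q - 1) * (C₁ * (∫⁻ x, g x ^ p) ^ (q / p) + C₂ * (∫⁻ x, g x ^ p) ^ (q / p)) := by gcongr
      _ = _ := by ring

end CommutatorBound

/-! ### From the commutator or oscillation bound to BMO with bounded negative part. -/

section Necessity

open Metric Filter Topology

variable {n : ℕ}

theorem div_rpow_one_sub {V : ℝ≥0∞} (h0 : V ≠ 0) (ht : V ≠ ∞) (I : ℝ≥0∞) (γ : ℝ) :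
    I / V ^ (1 - γ) = I / V * V ^ γ := by
  rw [ENNReal.rpow_sub _ _ h0 ht, ENNReal.rpow_one, div_eq_mul_inv I, div_eq_mul_inv V,
    ENNReal.mul_inv (Or.inl h0) (Or.inl ht), inv_inv, div_eq_mul_inv, mul_assoc]

/-- The averages over the cubes `Q` of `((|b|_Q - b)⁺) ^ s` are bounded. -/
def HasUpperDeviationBound (b : (Fin n → ℝ) → ℝ) (s : ℝ) : Prop :=
  ∃ C : ℝ≥0∞, C ≠ ∞ ∧ ∀ Q : Set (Fin n → ℝ), IsCube Q →
    ∫⁻ x in Q, ENNReal.ofReal ((⨍ y in Q, |b y|) - b x) ^ s ≤ C * volume Q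

theorem IsCube.setIntegral_average_sub {Q : Set (Fin n → ℝ)} (hQ : IsCube Q)
    {f b : (Fin n → ℝ) → ℝ} (hf : IntegrableOn f Q) (hb : IntegrableOn b Q) :
    ∫ x in Q, ((⨍ y in Q, f y) - b x) = ∫ x in Q, (f x - b x) := by
  have hfin : IsFiniteMeasure (volume.restrict Q) :=
    ⟨by rw [Measure.restrict_apply_univ]; exact hQ.volume_ne_top.lt_top⟩
  rw [integral_sub (integrable_const _) hb, integral_sub hf hb, integral_average]

/-- Hölder reduces to first powers. On Q the function b_Q - b has mean zero, so its absolute value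
integrates to twice its positive part, which is at most (|b|_Q - b)⁺. Moreover b⁻ ≤ |b| - b, and the
latter has the same integral over Q as |b|_Q - b; so the averages of b⁻ are bounded, and Lebesgue
differentiation bounds b⁻ almost everywhere. -/
theorem HasUpperDeviationBound.isBMO {b : (Fin n → ℝ) → ℝ} (hb : LocallyIntegrable b volume)
    {s : ℝ} (hs : 1 ≤ s) (h : HasUpperDeviationBound b s) :
    IsBMO b ∧ MemLp (fun x => max (-b x) 0) ∞ volume := by
  have hs0 : 0 < s := by linarith
  obtain ⟨C, hC, hCQ⟩ := h
  obtain ⟨K, hK⟩ : ∃ K : ℝ≥0, C ^ (1 / s) = K :=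
    ⟨(C ^ (1 / s)).toNNReal, (ENNReal.coe_toNNReal
      (ENNReal.rpow_ne_top_of_nonneg (by positivity) hC)).symm⟩
  have hKQ : ∀ Q : Set (Fin n → ℝ), IsCube Q →
      ∫ x in Q, max ((⨍ y in Q, |b y|) - b x) 0 ≤ K * volume.real Q := by
    intro Q hQ
    have hbQ := hQ.integrableOn hb
    have hfin : IsFiniteMeasure (volume.restrict Q) :=
      ⟨by rw [Measure.restrict_apply_univ]; exact hQ.volume_ne_top.lt_top⟩
    have hint : Integrable (fun x => max ((⨍ y in Q, |b y|) - b x) 0) (volume.restrict Q) :=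
      ((integrable_const _).sub hbQ).pos_part
    rw [← ENNReal.ofReal_le_ofReal_iff (by positivity), ofReal_integral_eq_lintegral_ofReal hint
      (Eventually.of_forall fun _ => le_max_right _ _), ENNReal.ofReal_mul K.coe_nonneg,
      ENNReal.ofReal_coe_nnreal, measureReal_def, ENNReal.ofReal_toReal hQ.volume_ne_top]
    have hof : ∀ x, ENNReal.ofReal (max ((⨍ y in Q, |b y|) - b x) 0)
        = ENNReal.ofReal ((⨍ y in Q, |b y|) - b x) := fun x => by
      rw [ENNReal.ofReal_max, ENNReal.ofReal_zero, max_eq_left zero_le]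
    simp_rw [hof]
    refine (lintegral_le_rpow_mul_measure_univ hs
      ((integrable_const _).sub hbQ).aemeasurable.ennreal_ofReal).trans ?_
    rw [Measure.restrict_apply_univ]
    calc (∫⁻ x in Q, ENNReal.ofReal ((⨍ y in Q, |b y|) - b x) ^ s) ^ (1 / s) * volume Q ^ (1 - 1 / s)
        ≤ (C * volume Q) ^ (1 / s) * volume Q ^ (1 - 1 / s) := by
          gcongr
          exact hCQ Q hQ
      _ = K * volume Q := by
          rw [ENNReal.mul_rpow_of_nonneg _ _ (by positivity), hK, mul_assoc,
            ← ENNReal.rpow_add _ _ hQ.volume_ne_zero hQ.volume_ne_top, add_sub_cancel,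
            ENNReal.rpow_one]
  constructor
  · refine isBMO_iff.2 ⟨2 * K + 1, by positivity, hb, fun Q hQ => ?_⟩
    have hbQ := hQ.integrableOn hb
    have hfin : IsFiniteMeasure (volume.restrict Q) :=
      ⟨by rw [Measure.restrict_apply_univ]; exact hQ.volume_ne_top.lt_top⟩
    set m := ⨍ y in Q, b y with hm
    have hdiff : Integrable (fun x => m - b x) (volume.restrict Q) := (integrable_const _).sub hbQ
    have hmle : m ≤ ⨍ y in Q, |b y| := by
      rw [hm, setAverage_eq, setAverage_eq]
      exact smul_le_smul_of_nonneg_left (integral_mono hbQ hbQ.abs fun x => le_abs_self _)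
        (by positivity)
    have hint : ∫ x in Q, ‖b x - m‖ ≤ 2 * (K * volume.real Q) := by
      calc ∫ x in Q, ‖b x - m‖ = ∫ x in Q, (2 * max (m - b x) 0 - (m - b x)) := by
            refine integral_congr_ae (Eventually.of_forall fun x => ?_)
            simp only [Real.norm_eq_abs]
            rcases le_total (m - b x) 0 with h | h
            · rw [max_eq_right h, abs_of_nonneg (by linarith)]; ring
            · rw [max_eq_left h, abs_of_nonpos (by linarith)]; ring
        _ = 2 * ∫ x in Q, max (m - b x) 0 := by
            rw [integral_sub (hdiff.pos_part.const_mul 2) hdiff, integral_const_mul,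
              hm, hQ.setIntegral_average_sub hbQ hbQ]
            simp
        _ ≤ 2 * ∫ x in Q, max ((⨍ y in Q, |b y|) - b x) 0 := by
            refine mul_le_mul_of_nonneg_left ?_ zero_le_two
            refine integral_mono hdiff.pos_part
              (((integrable_const _).sub hbQ).pos_part) fun x => ?_
            exact max_le_max (sub_le_sub_right hmle _) le_rfl
        _ ≤ _ := by
            gcongr
            exact hKQ Q hQ
    rw [← ofReal_integral_norm_eq_lintegral_enorm (f := fun x => b x - m)
      (hbQ.sub (integrable_const m))]
    refine (ENNReal.ofReal_le_ofReal hint).trans ?_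
    rw [← mul_assoc, ENNReal.ofReal_mul (by positivity), measureReal_def,
      ENNReal.ofReal_toReal hQ.volume_ne_top, ENNReal.ofReal_mul zero_le_two,
      ENNReal.ofReal_coe_nnreal, ENNReal.ofReal_ofNat]
    gcongr
    push_cast
    exact le_self_add
  · have hneg : LocallyIntegrable (fun x => max (-b x) 0) volume := by
      intro x
      obtain ⟨U, hU, hi⟩ := hb x
      exact ⟨U, hU, hi.neg_part⟩
    refine memLp_top_of_bound hneg.aestronglyMeasurable K ?_
    filter_upwards [ae_exists_lt_setAverage hneg] with x hx
    rw [Real.norm_of_nonneg (le_max_right _ _)]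
    by_contra! hlt
    obtain ⟨r, hr0, -, hr⟩ := hx K hlt 1 one_pos
    have hQ := isCube_closedBall x hr0
    refine absurd hr (not_lt.2 ?_)
    have hbQ := hQ.integrableOn hb
    have hV : 0 < volume.real (closedBall x r) :=
      ENNReal.toReal_pos hQ.volume_ne_zero hQ.volume_ne_top
    have hfin : IsFiniteMeasure (volume.restrict (closedBall x r)) :=
      ⟨by rw [Measure.restrict_apply_univ]; exact hQ.volume_ne_top.lt_top⟩
    rw [setAverage_eq, smul_eq_mul, inv_mul_le_iff₀ hV, mul_comm]
    calc ∫ y in closedBall x r, max (-b y) 0 ≤ ∫ y in closedBall x r, (|b y| - b y) := by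
          refine integral_mono hbQ.neg_part (hbQ.abs.sub hbQ) fun y => ?_
          exact max_le (by linarith [abs_nonneg (b y)]) (by linarith [le_abs_self (b y)])
      _ = ∫ y in closedBall x r, ((⨍ z in closedBall x r, |b z|) - b y) :=
          (hQ.setIntegral_average_sub hbQ.abs hbQ).symm
      _ ≤ ∫ y in closedBall x r, max ((⨍ z in closedBall x r, |b z|) - b y) 0 :=
          integral_mono ((integrable_const _).sub hbQ) ((integrable_const _).sub hbQ).pos_part
            fun y => le_max_left _ _
      _ ≤ _ := hKQ _ hQ

theorem IsCube.ofReal_average_abs {b : (Fin n → ℝ) → ℝ} (hb : LocallyIntegrable b volume)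
    {Q : Set (Fin n → ℝ)} (hQ : IsCube Q) :
    ENNReal.ofReal (⨍ y in Q, |b y|) = (∫⁻ y in Q, ‖b y‖ₑ) / volume Q := by
  rw [ofReal_setAverage (hQ.integrableOn hb).abs (Eventually.of_forall fun _ => abs_nonneg _)]
  simp_rw [← Real.norm_eq_abs, ofReal_norm]

/-- No competitor Q' beats Q: if larger, the numerator is at most |Q| and the denominator grows; if
smaller, the quotient is at most |Q'|^(α/n). -/
theorem eFracMax_indicator_one {α : ℝ} (hα : 0 ≤ α) (hαn : α < n) {Q : Set (Fin n → ℝ)}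
    (hQ : IsCube Q) {x : Fin n → ℝ} (hx : x ∈ Q) :
    eFracMax α (Q.indicator 1) x = volume Q ^ (α / n) := by
  have hn : (0 : ℝ) < n := by linarith
  have hα0 : 0 ≤ α / n := by positivity
  have hα1 : 0 ≤ 1 - α / n := by rw [sub_nonneg, div_le_one hn]; exact hαn.le
  have key : ∀ V : ℝ≥0∞, V ≠ 0 → V ≠ ∞ → V / V ^ (1 - α / n) = V ^ (α / n) := fun V h0 ht => by
    rw [div_rpow_one_sub h0 ht, ENNReal.div_self h0 ht, one_mul]
  refine le_antisymm (eFracMax_le_iff.2 fun Q' hQ' _ => ?_) ?_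
  · rw [lintegral_indicator_one hQ.measurableSet, Measure.restrict_apply hQ.measurableSet]
    rcases le_total (volume Q) (volume Q') with h | h
    · calc volume (Q ∩ Q') / volume Q' ^ (1 - α / n) ≤ volume Q / volume Q ^ (1 - α / n) := by
            gcongr
            exact Set.inter_subset_left
        _ = _ := key _ hQ.volume_ne_zero hQ.volume_ne_top
    · calc volume (Q ∩ Q') / volume Q' ^ (1 - α / n) ≤ volume Q' / volume Q' ^ (1 - α / n) := by
            gcongr
            exact Set.inter_subset_right
        _ = volume Q' ^ (α / n) := key _ hQ'.volume_ne_zero hQ'.volume_ne_top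
        _ ≤ _ := by gcongr
  · refine le_trans (le_of_eq ?_) (le_eFracMax hQ hx)
    rw [lintegral_indicator_one hQ.measurableSet, Measure.restrict_apply_self,
      key _ hQ.volume_ne_zero hQ.volume_ne_top]

/-- The commutator is tested on the indicator of Q. Its negative is at least |Q|^(α/n) (|b|_Q - b)
on Q, and the exponent relation balances the powers of |Q|. -/
theorem FracCommutatorBounded.hasUpperDeviationBound {α : ℝ} (hα : 0 < α) (hαn : α < n)
    {b : (Fin n → ℝ) → ℝ} (hb : LocallyIntegrable b volume) {p q : ℝ} (hp : 1 < p) (hpq : p < q)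
    (hpα : 1 / q = 1 / p - α / n) (h : FracCommutatorBounded α b p q) :
    HasUpperDeviationBound b q := by
  have hp0 : 0 < p := by linarith
  have hq0 : 0 < q := by linarith
  have hn : (0 : ℝ) < n := by linarith
  obtain ⟨C, hC⟩ := h
  refine ⟨C ^ q, ENNReal.rpow_ne_top_of_nonneg hq0.le ENNReal.coe_ne_top, fun Q hQ => ?_⟩
  set V := volume Q with hV
  have hV0 : V ≠ 0 := hQ.volume_ne_zero
  have hVt : V ≠ ∞ := hQ.volume_ne_top
  obtain ⟨hfin, -, hnorm⟩ := hC (Q.indicator 1)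
    (memLp_indicator_const _ hQ.measurableSet (1 : ℝ) (Or.inr hVt))
  have hv0 : V ^ (α / n) ≠ 0 := by simp [ENNReal.rpow_eq_zero_iff, hV0, hVt]
  have hvt : V ^ (α / n) ≠ ∞ := by simp [ENNReal.rpow_eq_top_iff, hV0, hVt]
  have hpt : ∀ᵐ x, x ∈ Q → V ^ (α / n) * ENNReal.ofReal ((⨍ y in Q, |b y|) - b x)
      ≤ ‖fracCommutator α b (Q.indicator 1) x‖ₑ := by
    filter_upwards [hfin] with x hx hxQ
    have h1 : fracMax α (Q.indicator 1) x = V ^ (α / n) := by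
      rw [← eFracMax_indicator_one hα.le hαn hQ hxQ, fracMax_eq]
      congr 1
      funext y
      by_cases hy : y ∈ Q <;> simp [hy]
    have h2 : V ^ (α / n) * ENNReal.ofReal (⨍ y in Q, |b y|)
        ≤ fracMax α (fun y => b y * Q.indicator (1 : (Fin n → ℝ) → ℝ) y) x := by
      rw [fracMax_eq]
      refine le_trans (le_of_eq ?_) (le_eFracMax hQ hxQ)
      rw [hQ.ofReal_average_abs hb, ← hV, div_rpow_one_sub hV0 hVt, mul_comm]
      congr 2
      refine setLIntegral_congr_fun hQ.measurableSet fun y hy => ?_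
      simp [Set.indicator_of_mem hy]
    set v := (V ^ (α / n)).toReal with hv
    have hvV : V ^ (α / n) = ENNReal.ofReal v := (ENNReal.ofReal_toReal hvt).symm
    have hA0 : 0 ≤ ⨍ y in Q, |b y| := by
      rw [setAverage_eq]
      exact smul_nonneg (by positivity) (integral_nonneg fun _ => abs_nonneg _)
    have h3 : v * (⨍ y in Q, |b y|)
        ≤ (fracMax α (fun y => b y * Q.indicator (1 : (Fin n → ℝ) → ℝ) y) x).toReal := by
      -- Finiteness matters: at an infinite value `toReal` would return 0 and the lower bound would
      -- be lost.
      have := ENNReal.toReal_mono hx.2.ne h2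
      rwa [ENNReal.toReal_mul, ENNReal.toReal_ofReal hA0] at this
    rw [hvV, ← ENNReal.ofReal_mul ENNReal.toReal_nonneg, ← ofReal_norm, Real.norm_eq_abs]
    refine ENNReal.ofReal_le_ofReal (le_trans ?_ (neg_le_abs _))
    rw [fracCommutator, h1, ← hv]
    linarith
  have hq0' : ENNReal.ofReal q ≠ 0 := by simpa using hq0
  have hp0' : ENNReal.ofReal p ≠ 0 := by simpa using hp0
  have hint : ∫⁻ x, ‖fracCommutator α b (Q.indicator 1) x‖ₑ ^ q ≤ (C * V ^ (1 / p)) ^ q := by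
    rw [eLpNorm_eq_lintegral_rpow_enorm_toReal hq0' ENNReal.ofReal_ne_top,
      ENNReal.toReal_ofReal hq0.le] at hnorm
    have h4 : eLpNorm (Q.indicator (1 : (Fin n → ℝ) → ℝ)) (ENNReal.ofReal p) volume = V ^ (1 / p) := by
      have := eLpNorm_indicator_const (c := (1 : ℝ)) (μ := volume) hQ.measurableSet hp0'
        ENNReal.ofReal_ne_top
      simpa [ENNReal.toReal_ofReal hp0.le, Pi.one_def] using this
    rw [h4] at hnorm
    calc _ = ((∫⁻ x, ‖fracCommutator α b (Q.indicator 1) x‖ₑ ^ q) ^ (1 / q)) ^ q := by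
          rw [← ENNReal.rpow_mul, one_div_mul_cancel hq0.ne', ENNReal.rpow_one]
      _ ≤ _ := ENNReal.rpow_le_rpow hnorm hq0.le
  have hle : (V ^ (α / n)) ^ q * ∫⁻ x in Q, ENNReal.ofReal ((⨍ y in Q, |b y|) - b x) ^ q
      ≤ (V ^ (α / n)) ^ q * (C ^ q * V) := by
    calc (V ^ (α / n)) ^ q * ∫⁻ x in Q, ENNReal.ofReal ((⨍ y in Q, |b y|) - b x) ^ q
        = ∫⁻ x in Q, (V ^ (α / n) * ENNReal.ofReal ((⨍ y in Q, |b y|) - b x)) ^ q := by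
          rw [← lintegral_const_mul' _ _ (ENNReal.rpow_ne_top_of_nonneg hq0.le hvt)]
          simp_rw [ENNReal.mul_rpow_of_nonneg _ _ hq0.le]
      _ ≤ ∫⁻ x in Q, ‖fracCommutator α b (Q.indicator 1) x‖ₑ ^ q := by
          refine lintegral_mono_ae ((ae_restrict_iff' hQ.measurableSet).2 ?_)
          filter_upwards [hpt] with x hx hxQ
          exact ENNReal.rpow_le_rpow (hx hxQ) hq0.le
      _ ≤ (C * V ^ (1 / p)) ^ q := (setLIntegral_le_lintegral _ _).trans hint
      _ = _ := by
          rw [ENNReal.mul_rpow_of_nonneg _ _ hq0.le, mul_left_comm]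
          congr 1
          nth_rewrite 3 [← ENNReal.rpow_one V]
          rw [← ENNReal.rpow_mul, ← ENNReal.rpow_mul, ← ENNReal.rpow_add _ _ hV0 hVt]
          congr 1
          have : 1 / p = 1 / q + α / n := by linarith
          rw [this]
          field_simp
          ring
  refine (ENNReal.mul_le_mul_iff_right ?_ (ENNReal.rpow_ne_top_of_nonneg hq0.le hvt)).1 hle
  simp [ENNReal.rpow_eq_zero_iff, hv0, hvt]

theorem average_le_fracMaxOn {α : ℝ} {b : (Fin n → ℝ) → ℝ} {Q : Set (Fin n → ℝ)} (hQ : IsCube Q)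
    {x : Fin n → ℝ} (hx : x ∈ Q) :
    (∫⁻ y in Q, ‖b y‖ₑ) / volume Q ≤ volume Q ^ (-α / n) * fracMaxOn α Q b x := by
  have h : (∫⁻ y in Q, ‖b y‖ₑ) / volume Q ^ (1 - α / n) ≤ fracMaxOn α Q b x :=
    le_iSup_of_le Q (le_iSup_of_le hQ (le_iSup_of_le hx (le_iSup_of_le subset_rfl le_rfl)))
  refine le_trans (le_of_eq ?_) (mul_le_mul_right h _)
  rw [div_rpow_one_sub hQ.volume_ne_zero hQ.volume_ne_top, mul_left_comm, ← ENNReal.rpow_add _ _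
    hQ.volume_ne_zero hQ.volume_ne_top, neg_div, neg_add_cancel, ENNReal.rpow_zero, mul_one]

/-- For Q' ⊆ Q the fractional factor |Q'|^(α/n) is at most |Q|^(α/n), which the normalization
removes; an ordinary average remains. -/
theorem fracMaxOn_le {α : ℝ} (hα : 0 ≤ α) {b : (Fin n → ℝ) → ℝ} {Q : Set (Fin n → ℝ)}
    (hQ : IsCube Q) (x : Fin n → ℝ) :
    volume Q ^ (-α / n) * fracMaxOn α Q b x ≤ eFracMax 0 (Q.indicator fun y => ‖b y‖ₑ) x := by
  have hα0 : 0 ≤ α / n := by positivity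
  have hneg : volume Q ^ (-α / n) = (volume Q ^ (α / n))⁻¹ := by rw [neg_div, ENNReal.rpow_neg]
  rw [hneg, mul_comm, ← div_eq_mul_inv, ENNReal.div_le_iff
    (by simp [ENNReal.rpow_eq_zero_iff, hQ.volume_ne_zero, hQ.volume_ne_top])
    (by simp [ENNReal.rpow_eq_top_iff, hQ.volume_ne_zero, hQ.volume_ne_top])]
  refine iSup_le fun Q' => iSup_le fun hQ' => iSup_le fun hx => iSup_le fun hsub => ?_
  calc (∫⁻ y in Q', ‖b y‖ₑ) / volume Q' ^ (1 - α / n)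
      = (∫⁻ y in Q', Q.indicator (fun y => ‖b y‖ₑ) y) / volume Q' * volume Q' ^ (α / n) := by
        rw [setLIntegral_congr_fun (f := Q.indicator fun y => ‖b y‖ₑ) (g := fun y => ‖b y‖ₑ)
          hQ'.measurableSet fun y hy => by simp [hsub hy],
          div_rpow_one_sub hQ'.volume_ne_zero hQ'.volume_ne_top]
    _ ≤ eFracMax 0 (Q.indicator fun y => ‖b y‖ₑ) x * volume Q ^ (α / n) := by
        gcongr
        exact average_le_eFracMax hQ' hx

/-- Q itself competes in the local maximal function, so the normalized value is at least |b|_Q, and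
|b|_Q - b is at most the oscillation wherever that value is finite, which is almost everywhere on Q.
-/
theorem hasUpperDeviationBound_of_fracOscillation_lt_top (hn : n ≠ 0) {α : ℝ} (hα : 0 ≤ α)
    {b : (Fin n → ℝ) → ℝ} (hb : LocallyIntegrable b volume) {s : ℝ} (hs : 0 < s)
    (h : fracOscillation α b s < ∞) : HasUpperDeviationBound b s := by
  refine ⟨fracOscillation α b s ^ s, ENNReal.rpow_ne_top_of_nonneg hs.le h.ne, fun Q hQ => ?_⟩
  have h1 : ((∫⁻ x in Q, ‖b x - (volume Q ^ (-α / n) * fracMaxOn α Q b x).toReal‖ₑ ^ s) /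
      volume Q) ^ (1 / s) ≤ fracOscillation α b s := le_iSup₂_of_le Q hQ le_rfl
  have h2 := ENNReal.rpow_le_rpow h1 hs.le
  rw [← ENNReal.rpow_mul, one_div_mul_cancel hs.ne', ENNReal.rpow_one,
    ENNReal.div_le_iff hQ.volume_ne_zero hQ.volume_ne_top] at h2
  refine le_trans ?_ h2
  have hfin : ∫⁻ y, Q.indicator (fun y => ‖b y‖ₑ) y ≠ ∞ := by
    rw [lintegral_indicator hQ.measurableSet]
    exact (hQ.integrableOn hb).2.ne
  refine lintegral_mono_ae ((ae_restrict_iff' hQ.measurableSet).2 ?_)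
  filter_upwards [eFracMax_zero_lt_top_ae hn hfin] with x hx hxQ
  refine ENNReal.rpow_le_rpow ?_ hs.le
  have h3 := ENNReal.toReal_mono ((fracMaxOn_le hα hQ x).trans_lt hx).ne
    (average_le_fracMaxOn (α := α) (b := b) hQ hxQ)
  rw [← hQ.ofReal_average_abs hb] at h3
  rw [← ofReal_norm, Real.norm_eq_abs]
  refine ENNReal.ofReal_le_ofReal (le_trans ?_ (neg_le_abs _))
  have h4 := (le_max_left _ _).trans_eq (ENNReal.toReal_ofReal' (r := ⨍ y in Q, |b y|)).symm
  linarith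

end Necessity

/-! ### From BMO with bounded negative part to the commutator and oscillation bounds. -/

section Sufficiency

open Metric Filter Topology

variable {n : ℕ}

theorem mul_eFracMax {α : ℝ} {c : ℝ≥0∞} (hc : c ≠ ∞) (g : (Fin n → ℝ) → ℝ≥0∞) (x : Fin n → ℝ) :
    c * eFracMax α g x = eFracMax α (fun y => c * g y) x := by
  simp only [eFracMax, ENNReal.mul_iSup, lintegral_const_mul' _ _ hc, mul_div_assoc]

theorem exists_ae_neg_le {b : (Fin n → ℝ) → ℝ} (h : MemLp (fun x => max (-b x) 0) ∞ volume) :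
    ∃ L : ℝ≥0, ∀ᵐ x, -b x ≤ L := by
  refine ⟨(eLpNorm (fun x => max (-b x) 0) ∞ volume).toNNReal, ?_⟩
  filter_upwards [enorm_ae_le_eLpNormEssSup (fun x => max (-b x) 0) volume] with x hx
  rw [← eLpNorm_exponent_top] at hx
  have := ENNReal.toReal_mono h.2.ne hx
  rw [toReal_enorm, Real.norm_of_nonneg (le_max_right _ _)] at this
  exact (le_max_left _ _).trans this

/-- The triangle inequality between |b(x)| and |b(y)| under the integral shows that |b| M_α f and
M_α(bf) differ by at most the majorant H; the same estimate gives the finiteness of M_α(bf). -/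
theorem fracCommutatorBounded_of_isBMO {α : ℝ} (hn : n ≠ 0) {b : (Fin n → ℝ) → ℝ}
    (hb : IsBMO b) (hneg : MemLp (fun x => max (-b x) 0) ∞ volume) {p q : ℝ}
    (hp : 1 < p) (hpq : p < q) (hpα : 1 / q = 1 / p - α / n) : FracCommutatorBounded α b p q := by
  have hp0 : 0 < p := by linarith
  have hq0 : 0 < q := by linarith
  obtain ⟨K, hK, hbK⟩ := isBMO_iff.1 hb
  obtain ⟨L, hL⟩ := exists_ae_neg_le hneg
  obtain ⟨C₁, hC₁, h₁⟩ := hbK.exists_majorant hn hK hp hpq.le hpα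
  obtain ⟨C₂, hC₂, h₂⟩ := exists_strong_type_eFracMax hn hp hpq.le hpα
  have h2 : (2 : ℝ≥0∞) ^ (q - 1) ≠ ∞ := ENNReal.rpow_ne_top_of_nonneg (by linarith) (by simp)
  set C : ℝ≥0∞ := 2 ^ (q - 1) * (C₁ + (2 * L) ^ q * C₂) with hCdef
  have hC : C ≠ ∞ := ENNReal.mul_ne_top h2 (ENNReal.add_ne_top.2 ⟨hC₁, ENNReal.mul_ne_top
    (ENNReal.rpow_ne_top_of_nonneg hq0.le (ENNReal.mul_ne_top (by simp) (by simp))) hC₂⟩)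
  have hp0' : ENNReal.ofReal p ≠ 0 := by simpa using hp0
  have hq0' : ENNReal.ofReal q ≠ 0 := by simpa using hq0
  refine ⟨(C ^ (1 / q)).toNNReal, fun f hf => ?_⟩
  set g : (Fin n → ℝ) → ℝ≥0∞ := fun y => ‖f y‖ₑ with hg
  have hgm : AEMeasurable g := hf.1.enorm
  have hgp : ∫⁻ x, g x ^ p ≠ ∞ := by
    have := lintegral_rpow_enorm_lt_top_of_eLpNorm_lt_top hp0' ENNReal.ofReal_ne_top hf.2
    rw [ENNReal.toReal_ofReal hp0.le] at this
    exact this.ne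
  have hpow : ∀ D : ℝ≥0∞, D ≠ ∞ → D * (∫⁻ x, g x ^ p) ^ (q / p) ≠ ∞ := fun D hD =>
    ENNReal.mul_ne_top hD (ENNReal.rpow_ne_top_of_nonneg (by positivity) hgp)
  obtain ⟨H, hHm, hHpt, hHi⟩ := h₁ g hgm hgp
  have hM := measurable_eFracMax α g
  have hfin : ∀ F : (Fin n → ℝ) → ℝ≥0∞, AEMeasurable F → ∫⁻ x, F x ^ q ≠ ∞ → ∀ᵐ x, F x < ∞ := by
    intro F hF hFi
    filter_upwards [ae_lt_top' (hF.pow_const q) hFi] with x hx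
    by_contra hne
    rw [not_lt_top_iff.1 hne, ENNReal.top_rpow_of_pos hq0] at hx
    exact lt_irrefl _ hx
  have hHfin := hfin H hHm (ne_top_of_le_ne_top (hpow _ hC₁) hHi)
  have hMfin := hfin _ hM.aemeasurable (ne_top_of_le_ne_top (hpow _ hC₂) (h₂ g hgm))
  have hbf : ∀ y, ‖b y * f y‖ₑ = ‖b y‖ₑ * g y := fun y => enorm_mul _ _
  have hbm : AEMeasurable b := hbK.1.aestronglyMeasurable.aemeasurable
  have hup : ∀ x, fracMax α (fun y => b y * f y) x ≤ ‖b x‖ₑ * eFracMax α g x + H x := by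
    intro x
    rw [mul_eFracMax enorm_ne_top]
    refine eFracMax_le_iff.2 fun Q hQ hx => ?_
    refine le_trans ?_ (add_le_add (le_eFracMax hQ hx) (hHpt Q hQ x hx))
    rw [ENNReal.div_add_div_same, ← lintegral_add_left' (hgm.restrict.const_mul _)]
    refine ENNReal.div_le_div_right (lintegral_mono fun y => ?_) _
    rw [hbf, ← add_mul]
    gcongr
    calc ‖b y‖ₑ = ‖b x - (b x - b y)‖ₑ := by rw [sub_sub_cancel]
      _ ≤ _ := enorm_sub_le
  have hlow : ∀ x, ‖b x‖ₑ * eFracMax α g x ≤ fracMax α (fun y => b y * f y) x + H x := by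
    intro x
    rw [mul_eFracMax enorm_ne_top]
    refine eFracMax_le_iff.2 fun Q hQ hx => ?_
    refine le_trans ?_ (add_le_add (le_eFracMax hQ hx) (hHpt Q hQ x hx))
    simp_rw [hbf]
    rw [ENNReal.div_add_div_same, ← lintegral_add_left' (f := fun y => ‖b y‖ₑ * g y)
      (hbm.enorm.mul hgm).restrict]
    refine ENNReal.div_le_div_right (lintegral_mono fun y => ?_) _
    rw [← add_mul]
    gcongr
    calc ‖b x‖ₑ = ‖b y + (b x - b y)‖ₑ := by rw [add_sub_cancel]
      _ ≤ _ := enorm_add_le _ _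
  have hfinite : ∀ᵐ x, fracMax α f x < ∞ ∧ fracMax α (fun y => b y * f y) x < ∞ := by
    filter_upwards [hHfin, hMfin] with x hHx hMx
    exact ⟨hMx, (hup x).trans_lt (ENNReal.add_lt_top.2 ⟨ENNReal.mul_lt_top enorm_lt_top hMx, hHx⟩)⟩
  have hpt : ∀ᵐ x, ‖fracCommutator α b f x‖ₑ ≤ H x + 2 * L * eFracMax α g x := by
    filter_upwards [hHfin, hfinite, hL] with x hHx ⟨hMx, hbx⟩ hLx
    rw [fracMax_eq] at hMx
    have h3 := ENNReal.toReal_mono (ENNReal.add_lt_top.2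
      ⟨ENNReal.mul_lt_top enorm_lt_top hMx, hHx⟩).ne (hup x)
    have h4 := ENNReal.toReal_mono (ENNReal.add_lt_top.2 ⟨hbx, hHx⟩).ne (hlow x)
    rw [ENNReal.toReal_add (ENNReal.mul_lt_top enorm_lt_top hMx).ne hHx.ne, ENNReal.toReal_mul,
      toReal_enorm, Real.norm_eq_abs] at h3
    rw [ENNReal.toReal_add hbx.ne hHx.ne, ENNReal.toReal_mul, toReal_enorm, Real.norm_eq_abs] at h4
    set M := (eFracMax α g x).toReal with hMdef
    have hM0 : 0 ≤ M := ENNReal.toReal_nonneg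
    -- The lower bound on b enters only here, to pass from |b| M_α f to b M_α f.
    have h5 : |b x| - b x ≤ 2 * L := by
      rcases abs_cases (b x) with ⟨h, _⟩ | ⟨h, _⟩ <;> rw [h] <;> linarith [L.coe_nonneg]
    have h6 := mul_le_mul_of_nonneg_right h5 hM0
    have h7 := mul_le_mul_of_nonneg_right (le_abs_self (b x)) hM0
    have h8 : 0 ≤ 2 * (L : ℝ) * M := by positivity
    have h9 : |fracCommutator α b f x| ≤ (H x).toReal + 2 * L * M := by
      rw [fracCommutator, fracMax_eq α f, ← hMdef, abs_le]
      constructor <;> linarith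
    rw [← ofReal_norm, Real.norm_eq_abs]
    refine (ENNReal.ofReal_le_ofReal h9).trans_eq ?_
    rw [ENNReal.ofReal_add ENNReal.toReal_nonneg h8, ENNReal.ofReal_toReal hHx.ne,
      ENNReal.ofReal_mul (by positivity), ENNReal.ofReal_mul zero_le_two,
      ENNReal.ofReal_toReal hMx.ne, ENNReal.ofReal_coe_nnreal, ENNReal.ofReal_ofNat]
  have hnorm : eLpNorm (fracCommutator α b f) (ENNReal.ofReal q) volume
      ≤ (C ^ (1 / q)).toNNReal * eLpNorm f (ENNReal.ofReal p) volume := by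
    rw [eLpNorm_eq_lintegral_rpow_enorm_toReal hq0' ENNReal.ofReal_ne_top,
      eLpNorm_eq_lintegral_rpow_enorm_toReal hp0' ENNReal.ofReal_ne_top,
      ENNReal.toReal_ofReal hq0.le, ENNReal.toReal_ofReal hp0.le,
      ENNReal.coe_toNNReal (ENNReal.rpow_ne_top_of_nonneg (by positivity) hC)]
    have hi : ∫⁻ x, ‖fracCommutator α b f x‖ₑ ^ q ≤ C * (∫⁻ x, g x ^ p) ^ (q / p) := by
      calc ∫⁻ x, ‖fracCommutator α b f x‖ₑ ^ q
          ≤ ∫⁻ x, (H x + 2 * L * eFracMax α g x) ^ q := by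
            refine lintegral_mono_ae ?_
            filter_upwards [hpt] with x hx
            exact ENNReal.rpow_le_rpow hx hq0.le
        _ ≤ 2 ^ (q - 1) * ((∫⁻ x, H x ^ q) + ∫⁻ x, (2 * L * eFracMax α g x) ^ q) :=
            lintegral_add_rpow_le (by linarith) _ (hM.const_mul _).aemeasurable
        _ = 2 ^ (q - 1) * ((∫⁻ x, H x ^ q) + (2 * L) ^ q * ∫⁻ x, eFracMax α g x ^ q) := by
            simp_rw [ENNReal.mul_rpow_of_nonneg (2 * (L : ℝ≥0∞)) (eFracMax α g _) hq0.le]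
            rw [lintegral_const_mul _ (hM.pow_const q)]
        _ ≤ 2 ^ (q - 1) * (C₁ * (∫⁻ x, g x ^ p) ^ (q / p) +
            (2 * L) ^ q * (C₂ * (∫⁻ x, g x ^ p) ^ (q / p))) := by
            gcongr
            exact h₂ g hgm
        _ = _ := by rw [hCdef]; ring
    refine (ENNReal.rpow_le_rpow hi (by positivity)).trans_eq ?_
    rw [ENNReal.mul_rpow_of_nonneg _ _ (by positivity), ← ENNReal.rpow_mul]
    congr 2
    field_simp
  refine ⟨hfinite, ⟨?_, hnorm.trans_lt (ENNReal.mul_lt_top ENNReal.coe_lt_top hf.2)⟩, hnorm⟩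
  refine AEMeasurable.aestronglyMeasurable ?_
  exact (hbm.mul (measurable_eFracMax α _).ennreal_toReal.aemeasurable).sub
    (measurable_eFracMax α _).ennreal_toReal.aemeasurable

/-- The normalized local maximal function lies between |b_Q| and |b_Q| plus the maximal function of
the deviation, and |b_Q| - b_Q ≤ 2L since b ≥ -L almost everywhere. -/
theorem enorm_sub_fracMaxOn_le {α : ℝ} (hα : 0 ≤ α) {b : (Fin n → ℝ) → ℝ}
    (hb : LocallyIntegrable b volume) {L : ℝ≥0} (hL : ∀ᵐ x, -b x ≤ L)
    {Q : Set (Fin n → ℝ)} (hQ : IsCube Q) {x : Fin n → ℝ} (hx : x ∈ Q) :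
    ‖b x - (volume Q ^ (-α / n) * fracMaxOn α Q b x).toReal‖ₑ ≤ maxDeviation b Q x + 2 * L := by
  have hbQ := hQ.integrableOn hb
  have hfin : IsFiniteMeasure (volume.restrict Q) :=
    ⟨by rw [Measure.restrict_apply_univ]; exact hQ.volume_ne_top.lt_top⟩
  set m := ⨍ y in Q, b y with hm
  set M := eFracMax 0 (Q.indicator fun x => ‖b x - m‖ₑ) x with hM
  have hdev : maxDeviation b Q x = ‖b x - m‖ₑ + M := rfl
  rcases eq_or_ne M ∞ with hMt | hMt
  · rw [hdev, hMt]; simp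
  set w := volume Q ^ (-α / n) * fracMaxOn α Q b x with hw
  have hup : w ≤ ‖m‖ₑ + M := by
    refine (fracMaxOn_le hα hQ x).trans (eFracMax_le_iff.2 fun Q' hQ' hx' => ?_)
    rw [zero_div, sub_zero, ENNReal.rpow_one]
    refine le_trans ?_ (add_le_add le_rfl (average_le_eFracMax hQ' hx'))
    rw [ENNReal.div_le_iff hQ'.volume_ne_zero hQ'.volume_ne_top, add_mul,
      ENNReal.div_mul_cancel hQ'.volume_ne_zero hQ'.volume_ne_top, ← setLIntegral_const,
      ← lintegral_add_left measurable_const]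
    refine lintegral_mono fun y => ?_
    by_cases hy : y ∈ Q
    · simp only [Set.indicator_of_mem hy]
      calc ‖b y‖ₑ = ‖m + (b y - m)‖ₑ := by rw [add_sub_cancel]
        _ ≤ _ := enorm_add_le _ _
    · simp [hy]
  have hlow : ‖m‖ₑ ≤ w := by
    refine le_trans ?_ (average_le_fracMaxOn hQ hx)
    simpa using enorm_setAverage_sub_le hQ.volume_ne_zero hQ.volume_ne_top hbQ 0
  have hsum : ‖m‖ₑ + M ≠ ∞ := ENNReal.add_ne_top.2 ⟨enorm_ne_top, hMt⟩
  have h1 := ENNReal.toReal_mono hsum hup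
  have h2 := ENNReal.toReal_mono (ne_top_of_le_ne_top hsum hup) hlow
  rw [ENNReal.toReal_add enorm_ne_top hMt, toReal_enorm, Real.norm_eq_abs] at h1
  rw [toReal_enorm, Real.norm_eq_abs] at h2
  have hmL : -L ≤ m := by
    have hc : ⨍ _ in Q, (-L : ℝ) = -L := setAverage_const hQ.volume_ne_zero hQ.volume_ne_top _
    rw [← hc, hm, setAverage_eq, setAverage_eq]
    refine smul_le_smul_of_nonneg_left (integral_mono_ae (integrable_const _) hbQ ?_) (by positivity)
    filter_upwards [ae_restrict_of_ae hL] with y hy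
    linarith
  have h3 : |m| - m ≤ 2 * L := by
    rcases abs_cases m with ⟨h, _⟩ | ⟨h, _⟩ <;> rw [h] <;> linarith [L.coe_nonneg]
  have h4 : |b x - w.toReal| ≤ |b x - m| + M.toReal + 2 * L := by
    have h5 := abs_le.1 (le_refl |b x - m|)
    have h6 := le_abs_self m
    have h7 : 0 ≤ M.toReal := ENNReal.toReal_nonneg
    rw [abs_le]
    constructor <;> linarith [h5.1, h5.2, L.coe_nonneg]
  rw [hdev, ← ofReal_norm, Real.norm_eq_abs]
  refine (ENNReal.ofReal_le_ofReal h4).trans_eq ?_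
  rw [ENNReal.ofReal_add (by positivity) (by positivity), ENNReal.ofReal_add (by positivity)
    ENNReal.toReal_nonneg, ENNReal.ofReal_toReal hMt, ENNReal.ofReal_mul zero_le_two,
    ENNReal.ofReal_coe_nnreal, ENNReal.ofReal_ofNat, ← Real.norm_eq_abs, ofReal_norm]

theorem fracOscillation_lt_top_of_isBMO {α : ℝ} (hn : n ≠ 0) (hα : 0 ≤ α) {b : (Fin n → ℝ) → ℝ}
    (hb : IsBMO b) (hneg : MemLp (fun x => max (-b x) 0) ∞ volume) {s : ℝ} (hs : 1 ≤ s) :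
    fracOscillation α b s < ∞ := by
  obtain ⟨K, hK, hbK⟩ := isBMO_iff.1 hb
  obtain ⟨L, hL⟩ := exists_ae_neg_le hneg
  have hs0 : 0 < s := by linarith
  -- The moment bound needs an exponent above 1, while s = 1 is allowed; so 2s is used, together
  -- with t^s ≤ 1 + t^(2s).
  obtain ⟨C, hC, h⟩ := hbK.exists_lintegral_maxDeviation_le hn hK (q := 2 * s) (by linarith)
  have h2 : (2 : ℝ≥0∞) ^ (2 * s - 1) ≠ ∞ := ENNReal.rpow_ne_top_of_nonneg (by linarith) (by simp)
  set D : ℝ≥0∞ := 1 + 2 ^ (2 * s - 1) * (C + (2 * L) ^ (2 * s)) with hD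
  have hDt : D ≠ ∞ := ENNReal.add_ne_top.2 ⟨by simp, ENNReal.mul_ne_top h2 (ENNReal.add_ne_top.2
    ⟨hC, ENNReal.rpow_ne_top_of_nonneg (by positivity) (ENNReal.mul_ne_top (by simp) (by simp))⟩)⟩
  refine lt_of_le_of_lt (iSup₂_le fun Q hQ => ?_)
    (ENNReal.rpow_lt_top_of_nonneg (y := 1 / s) (by positivity) hDt)
  refine ENNReal.rpow_le_rpow ?_ (by positivity)
  rw [ENNReal.div_le_iff hQ.volume_ne_zero hQ.volume_ne_top]
  calc ∫⁻ x in Q, ‖b x - (volume Q ^ (-α / n) * fracMaxOn α Q b x).toReal‖ₑ ^ s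
      ≤ ∫⁻ x in Q, (1 + (maxDeviation b Q x + 2 * L) ^ (2 * s)) := by
        refine setLIntegral_mono' hQ.measurableSet fun x hx => ?_
        refine (ENNReal.rpow_le_rpow (enorm_sub_fracMaxOn_le hα hbK.1 hL hQ hx)
          hs0.le).trans ?_
        rcases le_total (maxDeviation b Q x + 2 * L) 1 with h1 | h1
        · exact (ENNReal.rpow_le_one h1 hs0.le).trans le_self_add
        · exact (ENNReal.rpow_le_rpow_of_exponent_le h1 (by linarith)).trans le_add_self
    _ = volume Q + ∫⁻ x in Q, (maxDeviation b Q x + 2 * L) ^ (2 * s) := by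
        rw [lintegral_add_left measurable_const, setLIntegral_one]
    _ ≤ volume Q + 2 ^ (2 * s - 1) * (C * volume Q + (2 * L) ^ (2 * s) * volume Q) := by
        gcongr
        refine (lintegral_add_rpow_le (by linarith) _ aemeasurable_const).trans ?_
        rw [setLIntegral_const]
        gcongr
        exact h Q hQ
    _ = D * volume Q := by rw [hD]; ring

/-- Positivity of q is not assumed: p < n/α makes 1/q positive, and α > 0 then gives the strict
inequality. -/
theorem lt_of_one_div_eq_sub {α p q : ℝ} (hα : 0 < α) (hαn : α < n) (hp : 1 < p) (hpn : p < n / α)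
    (h : 1 / q = 1 / p - α / n) : p < q := by
  have hn : (0 : ℝ) < n := by linarith
  have hp0 : 0 < p := by linarith
  have h1 : α / n < 1 / p := by
    rw [div_lt_div_iff₀ hn hp0, one_mul, mul_comm]
    exact (lt_div_iff₀ hα).1 hpn
  have hq : 0 < q := one_div_pos.1 (by linarith)
  refine lt_of_one_div_lt_one_div hq ?_
  rw [h]
  linarith [div_pos hα hn]

end Sufficiency

/-! ### The equivalence. -/

theorem mainTheorem5 (n : ℕ) (α : ℝ) (hα : 0 < α) (hαn : α < n)
    (b : (Fin n → ℝ) → ℝ) (hb : LocallyIntegrable b volume) :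
    List.TFAE [
      IsBMO b ∧ MemLp (fun x => max (-b x) 0) ∞ volume,
      ∃ p q : ℝ, 1 < p ∧ p < n / α ∧ 1 / q = 1 / p - α / n ∧ FracCommutatorBounded α b p q,
      ∀ p q : ℝ, 1 < p → p < n / α → 1 / q = 1 / p - α / n → FracCommutatorBounded α b p q,
      ∃ s : ℝ, 1 ≤ s ∧ fracOscillation α b s < ∞,
      ∀ s : ℝ, 1 ≤ s → fracOscillation α b s < ∞] := by
  have hn0 : (0 : ℝ) < n := by linarith
  have hn : n ≠ 0 := by
    rintro rfl
    simp at hn0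
  tfae_have 1 → 3 := fun ⟨hbmo, hneg⟩ p q hp hpn hq =>
    fracCommutatorBounded_of_isBMO hn hbmo hneg hp (lt_of_one_div_eq_sub hα hαn hp hpn hq) hq
  tfae_have 3 → 2 := fun h => by
    -- The range of admissible p is nonempty because α < n.
    obtain ⟨p, hp1, hp2⟩ := exists_between ((one_lt_div hα).2 hαn)
    have hq : 1 / (1 / p - α / n)⁻¹ = 1 / p - α / n := by rw [one_div, inv_inv]
    exact ⟨p, _, hp1, hp2, hq, h p _ hp1 hp2 hq⟩
  tfae_have 2 → 1 := fun ⟨p, q, hp, hpn, hq, h⟩ =>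
    have hpq := lt_of_one_div_eq_sub hα hαn hp hpn hq
    (h.hasUpperDeviationBound hα hαn hb hp hpq hq).isBMO hb (by linarith)
  tfae_have 1 → 5 := fun ⟨hbmo, hneg⟩ s hs => fracOscillation_lt_top_of_isBMO hn hα.le hbmo hneg hs
  tfae_have 5 → 4 := fun h => ⟨1, le_rfl, h 1 le_rfl⟩
  tfae_have 4 → 1 := fun ⟨s, hs, h⟩ =>
    (hasUpperDeviationBound_of_fracOscillation_lt_top hn hα.le hb (by linarith) h).isBMO hb hs
  tfae_finish
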